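/- All logarithms are to base $2$, all Hilbert spaces are finite dimensional, $\mu_X$ is the maximally mixed state on $X$, and $D(\rho\|\sigma)=\mathrm{Tr}\,\rho(\log\rho-\log\sigma)$ if $\mathrm{supp}\,\rho\subseteq\mathrm{supp}\,\sigma$, $D(\rho\|\sigma)=\infty$ otherwise. Let $\gamma\in(0,\frac12]$ be such that $M:=|C|/\gamma$ is an integer, let $\delta\in(0,\frac1{15})$, let $\Psi_{RC}$ and $\omega_C$ be quantum states and suppose that $k:=\min\{\lambda\in\mathbb R:\Psi_{RC}\preceq 2^{\lambda}\,\Psi_R\otimes\omega_C\}$ exists. Then there is a state $\sigma_C$ with $\omega_C\preceq\frac1{1-\gamma}\sigma_C$ whose eigenvalues are integer multiples of $\gamma/|C|$. Let $\sigma_C=\sum_c q(c)|c\rangle\langle c|$ be any such state, with any orthonormal eigenbasis $\{|c\rangle\}$, and put $m(c)=q(c)|C|/\gamma$ and $a=\max_c m(c)$. Let $E$ be a register with basis $|0\rangle,\dots,|a-1\rangle$, let $\sigma_{CE}=\frac{\gamma}{|C|}\sum_c\sum_{e<m(c)}|c\rangle\langle c|\otimes|e\rangle\langle e|$, and let $\mathcal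 H'=\mathrm{supp}(\sigma_{CE})$, with basis $\{|c\rangle|e\rangle: e<m(c)\}$. Let $n\ge\lfloor a^{1/\delta}\rfloor$ be an integer, $D$ a register with basis $|1\rangle,\dots,|d\rangle$, $d=|D|\ge n$, and $\xi^{s:n}_D=\left(\sum_{j=s}^n\frac1j\right)^{-1}\sum_{j=s}^n\frac1j|j\rangle\langle j|$. For $0\le b\le a$ let $W_b$ be a unitary on $D\otimes E$, with $W_b|j\rangle_D|0\rangle_E=|\lfloor j/b\rfloor\rangle_D|j\bmod b\rangle_E$ for $a\le j\le n$ if $b\ge1$, and let $W=\sum_c|c\rangle\langle c|_C\otimes W_{m(c)}$. Let $Q$ be a qubit, $p$ a prime and $F$ a register with $|F|=p$ and $|0\rangle_Q\otimes\mathcal H'\otimes\mathcal H'\subseteq\mathcal H_F\subseteq \mathcal H_Q\otimes\mathcal H'\otimes\mathcal H'$, whose basis $|0\rangle,\dots,|p-1\rangle$ is a relabelling, by any one-to-one map, of product basis vectors $|q\rangle|c,e\rangle|c',e'\rangle$. For an integer $\ell$ let $U_\ell$ be the unitary on $F_1\otimes F_2$ (two copies of $F$) with $U_\ell|i\rangle|j\rangle=|i+(j-i)\ell\rangle|j+(j-i)\ell\rangle$,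 arithmetic modulo $p$. For a nonempty $S\subseteq\{0,\dots,M^2-1\}$ with $N=|S|$ put $$\tau=\frac1N\sum_{\ell\in S}U_\ell\Big(W\big(\Psi_{RC_0}\otimes|0\rangle\langle0|_{E_0}\otimes\xi_D^{a:n}\big)W^\dagger\otimes|0\rangle\langle0|_Q\otimes\sigma_{C_1E_1}\otimes\mu_{F_2}\Big)U_\ell^\dagger ,$$ where the state on $QC_0E_0C_1E_1$ is supported in $\mathcal H_{F_1}$. Then $\tau$ is a quantum state on $RDF_1F_2$ and $$D\big(\tau\,\big\|\,\Psi_R\otimes\mu_{F_1}\otimes\xi^{1:n}_D\otimes\mu_{F_2}\big)\le 15\delta+\log\Big(1+\frac{2^{k+2}-1}{N}\Big).$$ Moreover all these choices can be made with $|D|=n$ such that $\log|D|\le\frac1\delta\log\frac{|C|}\gamma$ and $\log|D|+2\log|F|\le\big(4+\frac1\delta\big)\log\frac{|C|}\gamma+2$. -/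

import Mathlib

open scoped Matrix Kronecker ComplexOrder

namespace FlatSplit

noncomputable section

/-- A quantum state (density matrix) on the Hilbert space `ℂ^ι`. -/
def IsState {ι : Type*} [Fintype ι] (ρ : Matrix ι ι ℂ) : Prop :=
  ρ.PosSemidef ∧ ρ.trace = 1

/-- The Loewner order. -/
def Loewner {ι : Type*} [Fintype ι] (A B : Matrix ι ι ℂ) : Prop :=
  (B - A).PosSemidef

/-- Max-relative entropy, `min {l : ρ ≤ 2^l σ}`; it is `⊤` if there is no such real `l`. -/
def dmax {ι : Type*} [Fintype ι] (ρ σ : Matrix ι ι ℂ) : EReal :=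
  sInf ((fun l : ℝ => (l : EReal)) '' {l : ℝ | Loewner ρ (((2 : ℝ) ^ l) • σ)})

open Classical in
/-- Umegaki relative entropy with logarithms in base two, `Tr ρ (log ρ - log σ)` if
`supp ρ ⊆ supp σ`, and `⊤` otherwise. The logarithm of a positive semidefinite matrix is taken
on its support (`Real.logb 2 0 = 0`). -/
def relEntropy {ι : Type*} [Fintype ι] [DecidableEq ι] (ρ σ : Matrix ι ι ℂ) : EReal :=
  if ∀ x : ι → ℂ, σ *ᵥ x = 0 → ρ *ᵥ x = 0 then
    (((ρ * (cfc (Real.logb 2) ρ - cfc (Real.logb 2) σ)).trace.re : ℝ) : EReal)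
  else ⊤

/-- The marginal on the first register. -/
def marginalLeft {R C : Type*} [Fintype C] (Ψ : Matrix (R × C) (R × C) ℂ) : Matrix R R ℂ :=
  Matrix.of fun r r' => ∑ c, Ψ (r, c) (r', c)

/-- The maximally mixed state. -/
def mixed (ι : Type*) [Fintype ι] [DecidableEq ι] : Matrix ι ι ℂ :=
  ((Fintype.card ι : ℝ)⁻¹) • (1 : Matrix ι ι ℂ)

/-- `S(a,n) = ∑_{j=a}^n 1/j`. -/
def harmonicSum (a n : ℕ) : ℝ := ∑ j ∈ Finset.Icc a n, (1 : ℝ) / j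

/-- The state `ξ^{a:n}` on a register `D` of dimension `d` whose basis is
`|1⟩, …, |d⟩`; the index `j : Fin d` stands for the vector `|j+1⟩`. -/
def xi (a n d : ℕ) : Matrix (Fin d) (Fin d) ℂ :=
  Matrix.diagonal fun j =>
    if a ≤ j.val + 1 ∧ j.val + 1 ≤ n then
      (((1 / ((j.val + 1 : ℕ) : ℝ)) / harmonicSum a n : ℝ) : ℂ)
    else 0

/-- `|0⟩⟨0|` on a register with basis `|0⟩, …, |a-1⟩`. -/
def ketbraZero (a : ℕ) : Matrix (Fin a) (Fin a) ℂ :=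
  Matrix.diagonal fun e => if e.val = 0 then 1 else 0

/-- `σ` is a rounding of `ω`: a state with `ω ≤ (1-γ)⁻¹ σ`, with an orthonormal eigenbasis
`|c⟩` (the columns of the unitary `V`) and with eigenvalues `q(c) = m(c) · γ/|C|`,
where the `m(c)` are integers. -/
structure IsRounding {C : Type*} [Fintype C] [DecidableEq C] (γ : ℝ) (ω σ : Matrix C C ℂ)
    (V : Matrix C C ℂ) (m : C → ℕ) : Prop where
  state : IsState σ
  dominates : Loewner ω ((1 / (1 - γ)) • σ)
  unitary : V ∈ Matrix.unitaryGroup C ℂ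
  eigen : σ = V * Matrix.diagonal (fun c => (((m c : ℝ) * (γ / Fintype.card C) : ℝ) : ℂ)) * Vᴴ

/-- `max_c m(c) = (|C|/γ) max_c q(c)`, the dimension `a` of the register `E`. -/
def maxMult {C : Type*} [Fintype C] (m : C → ℕ) : ℕ := Finset.univ.sup m

/-- The vector `|c⟩|e⟩` of `C ⊗ E`, where `|c⟩` is the `c`-th column of `V`. -/
def ketCE {C : Type*} {a : ℕ} (V : Matrix C C ℂ) (x : C × Fin a) : C × Fin a → ℂ :=
  fun y => V y.1 x.1 * (if y.2 = x.2 then 1 else 0)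

/-- The index set of the basis `|c⟩|e⟩`, `0 ≤ e < m(c)`, of the support of `σ_{CE}`. -/
abbrev FlatIndex {C : Type*} [Fintype C] (m : C → ℕ) : Type _ :=
  {x : C × Fin (maxMult m) // x.2.val < m x.1}

/-- The flattened state
`σ_{CE} = (γ/|C|) ∑_c ∑_{e < m(c)} |c⟩⟨c| ⊗ |e⟩⟨e|`. -/
def flatState {C : Type*} [Fintype C] (γ : ℝ) (V : Matrix C C ℂ) (m : C → ℕ) :
    Matrix (C × Fin (maxMult m)) (C × Fin (maxMult m)) ℂ :=
  (γ / Fintype.card C) •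
    ∑ x : FlatIndex m, Matrix.vecMulVec (ketCE V x.1) (star (ketCE V x.1))

/-- `Wb` is a unitary on `D ⊗ E` which acts as
`|j⟩_D |0⟩_E ↦ |⌊j/b⌋⟩_D |j mod b⟩_E` on the vectors in the support of `ξ^{a:n}_D ⊗ |0⟩⟨0|_E`
(its action on other vectors is left free; for `b = 0` it is any unitary). -/
def IsEmbezzler {d a : ℕ} (n b : ℕ) (Wb : Matrix (Fin d × Fin a) (Fin d × Fin a) ℂ) : Prop :=
  Wb ∈ Matrix.unitaryGroup (Fin d × Fin a) ℂ ∧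
    (0 < b → ∀ (j : Fin d) (e : Fin a), a ≤ j.val + 1 → j.val + 1 ≤ n → e.val = 0 →
      ∀ (j' : Fin d) (e' : Fin a), Wb (j', e') (j, e) =
        if j'.val + 1 = (j.val + 1) / b ∧ e'.val = (j.val + 1) % b then 1 else 0)

/-- The unitary `W = ∑_c |c⟩⟨c|_C ⊗ W_{m(c)}` on `C ⊗ (D ⊗ E)`. -/
def flattener {C : Type*} [Fintype C] {d : ℕ} (V : Matrix C C ℂ) (m : C → ℕ)
    (Wb : ℕ → Matrix (Fin d × Fin (maxMult m)) (Fin d × Fin (maxMult m)) ℂ) :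
    Matrix (C × (Fin d × Fin (maxMult m))) (C × (Fin d × Fin (maxMult m))) ℂ :=
  ∑ c, Matrix.vecMulVec (fun i => V i c) (star fun i => V i c) ⊗ₖ Wb (m c)

/-- `W (Ψ_{RC} ⊗ ξ^{a:n}_D ⊗ |0⟩⟨0|_E) W†`, with the registers in the order `(R D)(C E)`. -/
def flattened {R C : Type*} [Fintype R] [DecidableEq R] [Fintype C] {d : ℕ} (n : ℕ)
    (Ψ : Matrix (R × C) (R × C) ℂ) (V : Matrix C C ℂ) (m : C → ℕ)
    (Wb : ℕ → Matrix (Fin d × Fin (maxMult m)) (Fin d × Fin (maxMult m)) ℂ) :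
    Matrix ((R × Fin d) × (C × Fin (maxMult m))) ((R × Fin d) × (C × Fin (maxMult m))) ℂ :=
  let W := Matrix.reindex (Equiv.prodAssoc R C (Fin d × Fin (maxMult m))).symm
    (Equiv.prodAssoc R C (Fin d × Fin (maxMult m))).symm
    ((1 : Matrix R R ℂ) ⊗ₖ flattener V m Wb)
  Matrix.reindex (Equiv.prodProdProdComm R C (Fin d) (Fin (maxMult m)))
    (Equiv.prodProdProdComm R C (Fin d) (Fin (maxMult m)))
    (W * (Ψ ⊗ₖ (xi (maxMult m) n d ⊗ₖ ketbraZero (maxMult m))) * Wᴴ)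

/-- An identification of the basis `|0⟩, …, |p-1⟩` of the register `F` with basis vectors
`|q⟩|c,e⟩|c',e'⟩` of `Q ⊗ supp σ_{CE} ⊗ supp σ_{CE}`, where `|Q| = 2`, such that all the
vectors `|0⟩|c,e⟩|c',e'⟩` are used. Thus
`|0⟩ ⊗ supp σ_{CE} ⊗ supp σ_{CE} ⊆ F ⊆ Q ⊗ supp σ_{CE} ⊗ supp σ_{CE}`. -/
structure Labelling {C : Type*} [Fintype C] (m : C → ℕ) (p : ℕ) where
  toFun : ZMod p → Fin 2 × FlatIndex m × FlatIndex m
  injective : Function.Injective toFun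
  covers : ∀ x y : FlatIndex m, ∃ i, toFun i = (0, x, y)

/-- The isometry which embeds `F` into `(C E)((C E) Q)`. -/
def Labelling.embed {C : Type*} [Fintype C] {m : C → ℕ} {p : ℕ} (L : Labelling m p)
    (V : Matrix C C ℂ) :
    Matrix ((C × Fin (maxMult m)) × ((C × Fin (maxMult m)) × Fin 2)) (ZMod p) ℂ :=
  Matrix.of fun x i =>
    ketCE V (L.toFun i).2.1.1 x.1 * ketCE V (L.toFun i).2.2.1 x.2.1 *
      (if x.2.2 = (L.toFun i).1 then 1 else 0)

/-- The unitary `U_ℓ |i⟩|j⟩ = |i + (j-i)ℓ⟩|j + (j-i)ℓ⟩`, with arithmetic modulo `p`. -/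
def shear (p : ℕ) (l : ZMod p) : Matrix (ZMod p × ZMod p) (ZMod p × ZMod p) ℂ :=
  Matrix.of fun y x =>
    if y = (x.1 + (x.2 - x.1) * l, x.2 + (x.2 - x.1) * l) then 1 else 0

/-- `W (Ψ_{RC₀} ⊗ |0⟩⟨0|_{E₀} ⊗ ξ^{a:n}_D) W† ⊗ |0⟩⟨0|_Q ⊗ σ_{C₁E₁}`, regarded as an operator on
`(R D) F₁` through the inclusion of `F₁` into `C₀ E₀ C₁ E₁ Q`. -/
def inputState {R C : Type*} [Fintype R] [DecidableEq R] [Fintype C] {d p : ℕ}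
    (γ : ℝ) (n : ℕ) (Ψ : Matrix (R × C) (R × C) ℂ) (V : Matrix C C ℂ) (m : C → ℕ)
    (Wb : ℕ → Matrix (Fin d × Fin (maxMult m)) (Fin d × Fin (maxMult m)) ℂ)
    (L : Labelling m p) :
    Matrix ((R × Fin d) × ZMod p) ((R × Fin d) × ZMod p) ℂ :=
  let J := (1 : Matrix (R × Fin d) (R × Fin d) ℂ) ⊗ₖ L.embed V
  Jᴴ * Matrix.reindex (Equiv.prodAssoc _ _ _) (Equiv.prodAssoc _ _ _)
    (flattened n Ψ V m Wb ⊗ₖ (flatState γ V m ⊗ₖ ketbraZero 2)) * J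

/-- `τ_ℓ = U_ℓ (W (Ψ_{RC₀} ⊗ |0⟩⟨0|_{E₀} ⊗ ξ^{a:n}_D) W† ⊗ |0⟩⟨0|_Q ⊗ σ_{C₁E₁} ⊗ μ_{F₂}) U_ℓ†`,
with the registers in the order `(R D)(F₁ F₂)`. -/
def tauTerm {R C : Type*} [Fintype R] [DecidableEq R] [Fintype C] {d p : ℕ} [NeZero p]
    (γ : ℝ) (n : ℕ) (Ψ : Matrix (R × C) (R × C) ℂ) (V : Matrix C C ℂ) (m : C → ℕ)
    (Wb : ℕ → Matrix (Fin d × Fin (maxMult m)) (Fin d × Fin (maxMult m)) ℂ)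
    (L : Labelling m p) (l : ℕ) :
    Matrix ((R × Fin d) × (ZMod p × ZMod p)) ((R × Fin d) × (ZMod p × ZMod p)) ℂ :=
  let U := (1 : Matrix (R × Fin d) (R × Fin d) ℂ) ⊗ₖ shear p (l : ZMod p)
  U * Matrix.reindex (Equiv.prodAssoc _ _ _) (Equiv.prodAssoc _ _ _)
    (inputState γ n Ψ V m Wb L ⊗ₖ mixed (ZMod p)) * Uᴴ

/-- `τ = (1/|S|) ∑_{ℓ ∈ S} τ_ℓ`. -/
def tau {R C : Type*} [Fintype R] [DecidableEq R] [Fintype C] {d p : ℕ} [NeZero p]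
    (γ : ℝ) (n : ℕ) (Ψ : Matrix (R × C) (R × C) ℂ) (V : Matrix C C ℂ) (m : C → ℕ)
    (Wb : ℕ → Matrix (Fin d × Fin (maxMult m)) (Fin d × Fin (maxMult m)) ℂ)
    (L : Labelling m p) (S : Finset ℕ) :
    Matrix ((R × Fin d) × (ZMod p × ZMod p)) ((R × Fin d) × (ZMod p × ZMod p)) ℂ :=
  ((S.card : ℝ)⁻¹) • ∑ l ∈ S, tauTerm γ n Ψ V m Wb L l

/-- `Ψ_R ⊗ ξ^{1:n}_D ⊗ μ_{F₁} ⊗ μ_{F₂}`, in the order `(R D)(F₁ F₂)`. -/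
def target {R C : Type*} [Fintype C] (n d p : ℕ) [NeZero p] (Ψ : Matrix (R × C) (R × C) ℂ) :
    Matrix ((R × Fin d) × (ZMod p × ZMod p)) ((R × Fin d) × (ZMod p × ZMod p)) ℂ :=
  (marginalLeft Ψ ⊗ₖ xi 1 n d) ⊗ₖ (mixed (ZMod p) ⊗ₖ mixed (ZMod p))

end

end FlatSplit

/-!
The relative entropy is bounded without data processing, from two properties of the logarithm:
operator concavity and operator monotonicity. Let `τ = ∑ᵢ wᵢ Wᵢ† ρ Wᵢ` be a mixture of unitary
conjugates of `ρ`, and let `θ` be invariant under all `Wᵢ`. Then `Tr τ log θ = Tr ρ log θ`, whereas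
`Tr τ log τ = Tr ρ ∑ᵢ wᵢ log (Wᵢ τ Wᵢ†) ≤ Tr ρ log (∑ᵢ wᵢ Wᵢ τ Wᵢ†)`, so that `D(τ‖θ) ≤ log K` as
soon as `∑ᵢ wᵢ Wᵢ τ Wᵢ† ≤ K θ` (`relEntropy_le_of_twirl`). Adding `ε` to `τ` and to `θ` makes the
logarithms finite, and the limit `ε → 0` exists because the support of `τ` lies in that of `θ`.

For the state `τ` of the theorem, `Wᵢ` undoes a shear `U_l` and then applies a discrete Weyl
operator to `F₂`. Since `U_l† U_l'` is the shear with parameter `l' - l`, and a shear with nonzero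
parameter takes `ρ ⊗ μ` to a state with marginal `ρ_{RD} ⊗ μ` on `R D F₁`, the twirl of `τ` is
`(ρ / N + (1 - 1/N) ρ_{RD} ⊗ μ) ⊗ μ`. Hence only two bounds on the state `ρ` on `R D F₁` are
needed (`relEntropy_shear_le`): with `r = S(1,n) / S(a,n)`,
`ρ ≤ 2^(k+2) r Ψ_R ⊗ ξ^{1:n} ⊗ μ` and `ρ_{RD} ≤ r Ψ_R ⊗ ξ^{1:n}`.

In the eigenbasis of `σ_C`, the state `ρ` is the image of `Ψ_{RC}` under an explicit completely
positive map (`inputState_eq_decode`). By `1/j ≤ 1/(b ⌊j/b⌋)`, the unitary `W_b` takes `ξ^{a:n}`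
below `r ξ^{1:n}` tensored with the uniform distribution on `b` points (`cellWeight_le`); the second
bound follows. For the first bound, apply the map to
`Ψ_{RC} ≤ 2^k Ψ_R ⊗ ω_C ≤ 2^k (1-γ)⁻¹ Ψ_R ⊗ σ_C`: the image of `σ_C` is below `r ξ^{1:n}` tensored
with the uniform distribution on `M²` of the `p ≤ 2 M²` basis vectors of `F₁`, which accounts for a
factor two, and `(1-γ)⁻¹ ≤ 2` accounts for the other. Finally, `log r ≤ 15 δ` because `log a` is at
most `δ log (n+1)` (`logb_harmonicSum_ratio_le`).

The registers exist by Bertrand's postulate, and an injective partial map of basis vectors extends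
to a permutation, which is the embezzling unitary.
-/

/-! ### Operator concavity of the logarithm and twirling -/

theorem Matrix.IsHermitian.conj_cfc {n : Type*} [Fintype n] [DecidableEq n] {A : Matrix n n ℂ}
    (hA : A.IsHermitian) (W : Matrix.unitaryGroup n ℂ) (f : ℝ → ℝ) :
    (W : Matrix n n ℂ) * cfc f A * (W : Matrix n n ℂ)ᴴ =
      cfc f ((W : Matrix n n ℂ) * A * (W : Matrix n n ℂ)ᴴ) := by
  have hc : Continuous fun B : Matrix n n ℂ => Unitary.conjStarAlgAut ℂ (Matrix n n ℂ) W B := by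
    simp only [Unitary.conjStarAlgAut_apply]
    fun_prop
  have := StarAlgHom.map_cfc (R := ℝ) (S := ℂ)
    (Unitary.conjStarAlgAut ℂ (Matrix n n ℂ) W : Matrix n n ℂ →⋆ₐ[ℂ] Matrix n n ℂ)
    f A (Matrix.finite_real_spectrum.continuousOn _) hc hA
    (IsSelfAdjoint.map hA _)
  simpa [Unitary.conjStarAlgAut_apply, Matrix.star_eq_conjTranspose] using this

open scoped Matrix.Norms.L2Operator MatrixOrder in
/-- Jensen's inequality for the operator concave function `log` and an average of unitary
conjugates of `A`, followed by operator monotonicity. -/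
theorem Matrix.sum_conj_log_le {n ι : Type*} [Fintype n] [DecidableEq n] [Fintype ι]
    {w : ι → ℝ} (hw : ∀ i, 0 ≤ w i) (hw1 : ∑ i, w i = 1)
    (W : ι → Matrix.unitaryGroup n ℂ) {A B : Matrix n n ℂ} (hA : A.PosDef)
    (hAB : ∑ i, w i • ((W i : Matrix n n ℂ) * A * (W i : Matrix n n ℂ)ᴴ) ≤ B) :
    ∑ i, w i • ((W i : Matrix n n ℂ) * cfc Real.log A * (W i : Matrix n n ℂ)ᴴ) ≤
      cfc Real.log B := by
  have hpos : ∀ i, IsStrictlyPositive ((W i : Matrix n n ℂ) * A * (W i : Matrix n n ℂ)ᴴ) :=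
    fun i => Matrix.isStrictlyPositive_iff_posDef.2 <|
      (Matrix.IsUnit.posDef_star_right_conjugate_iff (Unitary.toUnits (W i)).isUnit).2 hA
  have hconc := CFC.concaveOn_log (A := Matrix n n ℂ)
  simp_rw [hA.1.conj_cfc]
  refine (hconc.le_map_sum (t := Finset.univ) (fun i _ => hw i) hw1 fun i _ => hpos i).trans ?_
  exact CFC.log_le_log hAB
    (hconc.1.sum_mem (t := Finset.univ) (fun i _ => hw i) hw1 fun i _ => hpos i)

open scoped Matrix.Norms.L2Operator MatrixOrder in
theorem Matrix.PosDef.cfc_log_smul {n : Type*} [Fintype n] [DecidableEq n] {B : Matrix n n ℂ}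
    (hB : B.PosDef) {K : ℝ} (hK : K ≠ 0) :
    cfc Real.log (K • B) = Real.log K • (1 : Matrix n n ℂ) + cfc Real.log B := by
  rw [← Algebra.algebraMap_eq_smul_one]
  exact CFC.log_smul B (fun x hx => (hB.isStrictlyPositive.spectrum_pos hx).ne') hK hB.1

namespace FlatSplit

theorem re_trace_mul_cfc {n : Type*} [Fintype n] [DecidableEq n] (A : Matrix n n ℂ)
    {B : Matrix n n ℂ} (hB : B.IsHermitian) (f : ℝ → ℝ) :
    (A * cfc f B).trace.re = ∑ i, f (hB.eigenvalues i) *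
      (((hB.eigenvectorUnitary : Matrix n n ℂ)ᴴ * A * hB.eigenvectorUnitary) i i).re := by
  rw [hB.cfc_eq, Matrix.IsHermitian.cfc, Unitary.conjStarAlgAut_apply, ← Matrix.mul_assoc,
    ← Matrix.mul_assoc, Matrix.trace_mul_comm, ← Matrix.mul_assoc, ← Matrix.mul_assoc,
    Matrix.trace]
  simp [Matrix.mul_diagonal, Matrix.star_eq_conjTranspose, mul_comm]

theorem re_trace_mul_logb {n : Type*} [Fintype n] [DecidableEq n] (A : Matrix n n ℂ)
    {B : Matrix n n ℂ} (hB : B.IsHermitian) :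
    (A * cfc (Real.logb 2) B).trace.re = (A * cfc Real.log B).trace.re / Real.log 2 := by
  rw [re_trace_mul_cfc A hB, re_trace_mul_cfc A hB, Finset.sum_div]
  simp only [Real.logb]
  exact Finset.sum_congr rfl fun i _ => by ring

/-- `Tr A log (B + ε) → Tr A log B` as `ε → 0+`, provided that `A` vanishes on the kernel of `B`:
the divergent terms `log ε` carry the weight zero, as does the convention `log 0 = 0`. -/
theorem tendsto_re_trace_mul_log {n : Type*} [Fintype n] [DecidableEq n] {A B : Matrix n n ℂ}
    (hB : B.IsHermitian) (hAB : ∀ x : n → ℂ, B *ᵥ x = 0 → A *ᵥ x = 0) :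
    Filter.Tendsto
      (fun ε : ℝ => (A * cfc Real.log (B + ε • (1 : Matrix n n ℂ))).trace.re)
      (nhdsWithin 0 (Set.Ioi 0)) (nhds (A * cfc Real.log B).trace.re) := by
  have h1 : ∀ ε : ℝ, cfc Real.log (B + ε • (1 : Matrix n n ℂ)) =
      cfc (fun x => Real.log (x + ε)) B := fun ε => by
    have hsa : IsSelfAdjoint B := hB
    have : B + ε • (1 : Matrix n n ℂ) = cfc (fun x => x + ε) B := by
      rw [cfc_add_const (R := ℝ) ε (fun x => x) B, cfc_id' ℝ B, Algebra.algebraMap_eq_smul_one]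
    rw [this, ← cfc_comp' Real.log (fun x => x + ε) B ?_]
    exact (Matrix.finite_real_spectrum.image _).continuousOn _
  simp_rw [h1, re_trace_mul_cfc A hB]
  refine tendsto_finsetSum _ fun i _ => ?_
  by_cases hi : hB.eigenvalues i = 0
  · have h0 : ((hB.eigenvectorUnitary : Matrix n n ℂ)ᴴ * A * hB.eigenvectorUnitary) i i = 0 := by
      have := hAB _ ((hB.mulVec_eigenvectorBasis i).trans (by rw [hi, zero_smul]))
      rw [Matrix.mul_assoc, Matrix.mul_apply]
      refine Finset.sum_eq_zero fun j _ => ?_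
      have h2 : (A * (hB.eigenvectorUnitary : Matrix n n ℂ)) j i = 0 := by
        have := congrFun this j
        simpa [Matrix.mul_apply, Matrix.mulVec, dotProduct,
          Matrix.IsHermitian.eigenvectorUnitary_apply] using this
      rw [h2, mul_zero]
    simp [h0]
  · refine Filter.Tendsto.mul_const _ ?_
    refine Filter.Tendsto.mono_left ?_ nhdsWithin_le_nhds
    have : ContinuousAt (fun ε : ℝ => Real.log (hB.eigenvalues i + ε)) 0 :=
      ContinuousAt.log (by fun_prop) (by simpa using hi)
    simpa [ContinuousAt] using this

open scoped MatrixOrder in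
theorem Loewner.re_trace_mul_le {n : Type*} [Fintype n] {A B P : Matrix n n ℂ}
    (hP : P.PosSemidef) (h : Loewner A B) : (P * A).trace.re ≤ (P * B).trace.re := by
  classical
  have h1 : 0 ≤ (P * (B - A)).trace := by
    obtain ⟨Q, rfl⟩ := CStarAlgebra.nonneg_iff_eq_star_mul_self.mp hP.nonneg
    rw [Matrix.star_eq_conjTranspose]
    rw [Matrix.mul_assoc, Matrix.trace_mul_comm]
    exact (h.mul_mul_conjTranspose_same Q).trace_nonneg
  rw [Matrix.mul_sub, Matrix.trace_sub] at h1
  have := (Complex.le_def.1 h1).1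
  simpa using this

/-- If `A ≤ K B`, then the support of `A` lies in that of `B`. -/
theorem Loewner.mulVec_eq_zero {n : Type*} [Fintype n] {A B : Matrix n n ℂ} {K : ℝ}
    (hA : A.PosSemidef) (h : Loewner A (K • B)) {x : n → ℂ} (hx : B *ᵥ x = 0) :
    A *ᵥ x = 0 := by
  rw [← hA.dotProduct_mulVec_zero_iff]
  refine le_antisymm ?_ (hA.dotProduct_mulVec_nonneg x)
  have := h.dotProduct_mulVec_nonneg x
  simpa [Matrix.sub_mulVec, Matrix.smul_mulVec, hx] using this

open scoped MatrixOrder in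
/-- If `τ` is the average of the states `Wᵢ† ρ Wᵢ`, the operator `θ` is invariant under the `Wᵢ`,
and the twirl `∑ᵢ wᵢ Wᵢ τ Wᵢ†` is at most `K θ`, then `D(τ‖θ) ≤ log K`. Indeed
`Tr τ log τ = Tr ρ ∑ᵢ wᵢ log (Wᵢ τ Wᵢ†) ≤ Tr ρ log (K θ)` since the logarithm is operator concave
and operator monotone, and `Tr τ log θ = Tr ρ log θ`. -/
theorem relEntropy_le_of_twirl {n ι : Type*} [Fintype n] [DecidableEq n] [Fintype ι]
    {w : ι → ℝ} (hw : ∀ i, 0 ≤ w i) (hw1 : ∑ i, w i = 1)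
    (W : ι → Matrix.unitaryGroup n ℂ) {ρ τ θ : Matrix n n ℂ} (hρ : IsState ρ)
    (hθ : θ.PosSemidef)
    (hτ : τ = ∑ i, w i • ((W i : Matrix n n ℂ)ᴴ * ρ * (W i : Matrix n n ℂ)))
    (hinv : ∀ i, (W i : Matrix n n ℂ) * θ * (W i : Matrix n n ℂ)ᴴ = θ)
    {K K' : ℝ} (hK : 1 ≤ K) (hρθ : Loewner ρ (K' • θ))
    (htw : Loewner (∑ i, w i • ((W i : Matrix n n ℂ) * τ * (W i : Matrix n n ℂ)ᴴ)) (K • θ)) :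
    IsState τ ∧ relEntropy τ θ ≤ ((Real.logb 2 K : ℝ) : EReal) := by
  have hWW : ∀ i, (W i : Matrix n n ℂ) * (W i : Matrix n n ℂ)ᴴ = 1 := fun i =>
    Matrix.mem_unitaryGroup_iff.1 (W i).2
  have hWW' : ∀ i, (W i : Matrix n n ℂ)ᴴ * (W i : Matrix n n ℂ) = 1 := fun i =>
    Matrix.mem_unitaryGroup_iff'.1 (W i).2
  have hinv' : ∀ i, (W i : Matrix n n ℂ)ᴴ * θ * (W i : Matrix n n ℂ) = θ := fun i => by
    conv_lhs => rw [← hinv i]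
    simp only [Matrix.mul_assoc]
    rw [hWW' i, Matrix.mul_one, ← Matrix.mul_assoc, hWW' i, Matrix.one_mul]
  have htr : ∀ Z : Matrix n n ℂ, (τ * Z).trace =
      (ρ * ∑ i, w i • ((W i : Matrix n n ℂ) * Z * (W i : Matrix n n ℂ)ᴴ)).trace := fun Z => by
    rw [hτ, Finset.sum_mul, Finset.mul_sum, Matrix.trace_sum, Matrix.trace_sum]
    refine Finset.sum_congr rfl fun i _ => ?_
    rw [Matrix.smul_mul, Matrix.mul_smul, Matrix.trace_smul, Matrix.trace_smul]
    congr 1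
    rw [Matrix.mul_assoc, Matrix.mul_assoc, Matrix.trace_mul_comm]
    simp only [Matrix.mul_assoc]
  have hτpsd : τ.PosSemidef := by
    rw [hτ]
    exact Matrix.posSemidef_sum _ fun i _ =>
      (hρ.1.conjTranspose_mul_mul_same _).smul (hw i)
  have hτ1 : τ.trace = 1 := by
    have := htr 1
    simp only [Matrix.mul_one, hWW, ← Finset.sum_smul, hw1, one_smul] at this
    rw [this, hρ.2]
  have hτθ : Loewner τ (K' • θ) := by
    have : K' • θ - τ =
        ∑ i, w i • ((W i : Matrix n n ℂ)ᴴ * (K' • θ - ρ) * (W i : Matrix n n ℂ)) := by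
      simp only [Matrix.mul_sub, Matrix.sub_mul, Matrix.mul_smul, Matrix.smul_mul, hinv',
        smul_sub, Finset.sum_sub_distrib, ← hτ, ← Finset.sum_smul, hw1, one_smul]
    rw [Loewner, this]
    exact Matrix.posSemidef_sum _ fun i _ =>
      (hρθ.conjTranspose_mul_mul_same _).smul (hw i)
  have hsupp : ∀ x : n → ℂ, θ *ᵥ x = 0 → τ *ᵥ x = 0 := fun x hx =>
    Loewner.mulVec_eq_zero hτpsd hτθ hx
  refine ⟨⟨hτpsd, hτ1⟩, ?_⟩
  rw [relEntropy, if_pos hsupp, EReal.coe_le_coe_iff, Matrix.mul_sub, Matrix.trace_sub,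
    Complex.sub_re, re_trace_mul_logb τ hτpsd.1, re_trace_mul_logb τ hθ.1, ← sub_div, Real.logb]
  refine div_le_div_of_nonneg_right ?_ (Real.log_nonneg one_le_two)
  have hlim := (tendsto_re_trace_mul_log hτpsd.1 fun x hx => hx).sub
    (tendsto_re_trace_mul_log hθ.1 hsupp)
  refine le_of_tendsto hlim ?_
  filter_upwards [self_mem_nhdsWithin] with ε hε
  have hε0 : 0 < ε := hε
  have hεpd : (ε • (1 : Matrix n n ℂ)).PosDef := Matrix.PosDef.one.smul hε0
  have hτε : (τ + ε • (1 : Matrix n n ℂ)).PosDef := Matrix.PosDef.posSemidef_add hτpsd hεpd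
  have hθε : (θ + ε • (1 : Matrix n n ℂ)).PosDef := Matrix.PosDef.posSemidef_add hθ hεpd
  have hconj : ∀ Z : Matrix n n ℂ,
      ∑ i, w i • ((W i : Matrix n n ℂ) * (Z + ε • (1 : Matrix n n ℂ)) * (W i : Matrix n n ℂ)ᴴ) =
      ∑ i, w i • ((W i : Matrix n n ℂ) * Z * (W i : Matrix n n ℂ)ᴴ) + ε • (1 : Matrix n n ℂ) :=
    fun Z => by
      simp only [Matrix.mul_add, Matrix.add_mul, smul_add, Finset.sum_add_distrib, Matrix.mul_smul,
        Matrix.smul_mul, Matrix.mul_one, hWW, ← Finset.sum_smul, hw1, one_smul]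
  -- concavity and monotonicity of the logarithm, with `ε ≤ K ε` as `1 ≤ K`
  have hup : (τ * cfc Real.log (τ + ε • (1 : Matrix n n ℂ))).trace.re ≤
      (ρ * cfc Real.log (K • (θ + ε • (1 : Matrix n n ℂ)))).trace.re := by
    rw [htr]
    refine Loewner.re_trace_mul_le hρ.1 (Matrix.sum_conj_log_le hw hw1 W hτε ?_)
    rw [hconj, smul_add]
    refine add_le_add htw ?_
    rw [Matrix.le_iff, smul_smul, ← sub_smul]
    exact Matrix.PosSemidef.one.smul (by nlinarith : 0 ≤ K * ε - ε)
  -- no inequality is lost here, since the `Wᵢ` commute with `log (θ + ε)`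
  have hdown : (τ * cfc Real.log (θ + ε • (1 : Matrix n n ℂ))).trace.re =
      (ρ * cfc Real.log (θ + ε • (1 : Matrix n n ℂ))).trace.re := by
    have h (i : ι) : (W i : Matrix n n ℂ) * cfc Real.log (θ + ε • (1 : Matrix n n ℂ)) *
        (W i : Matrix n n ℂ)ᴴ = cfc Real.log (θ + ε • (1 : Matrix n n ℂ)) := by
      rw [hθε.1.conj_cfc]
      simp only [Matrix.mul_add, Matrix.add_mul, Matrix.mul_smul, Matrix.smul_mul, Matrix.mul_one,
        hWW, hinv]
    rw [htr]
    simp only [h, ← Finset.sum_smul, hw1, one_smul]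
  have hmul : (ρ * cfc Real.log (K • (θ + ε • (1 : Matrix n n ℂ)))).trace.re =
      Real.log K + (ρ * cfc Real.log (θ + ε • (1 : Matrix n n ℂ))).trace.re := by
    rw [hθε.cfc_log_smul (by positivity), Matrix.mul_add, Matrix.trace_add, Matrix.mul_smul,
      Matrix.mul_one, Matrix.trace_smul, hρ.2]
    simp
  linarith

/-! ### Convex splitting with shears modulo a prime -/

/-- The monomial matrix `∑ₓ u(x) |x⟩⟨e(x)|`. -/
def monomialMatrix {n : Type*} [DecidableEq n] (e : n ≃ n) (u : n → ℂ) : Matrix n n ℂ :=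
  Matrix.of fun x y => if y = e x then u x else 0

section Monomial

variable {n : Type*} [Fintype n] [DecidableEq n] (e : n ≃ n) (u : n → ℂ) (A : Matrix n n ℂ)

theorem monomialMatrix_conj_apply (x y : n) :
    (monomialMatrix e u * A * (monomialMatrix e u)ᴴ) x y = u x * A (e x) (e y) * star (u y) := by
  simp [monomialMatrix, Matrix.mul_apply, apply_ite (starRingEnd ℂ)]

theorem monomialMatrix_conj'_apply (x y : n) :
    ((monomialMatrix e u)ᴴ * A * monomialMatrix e u) x y =
      star (u (e.symm x)) * A (e.symm x) (e.symm y) * u (e.symm y) := by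
  simp [monomialMatrix, Matrix.mul_apply, apply_ite (starRingEnd ℂ), ← Equiv.symm_apply_eq]

theorem monomialMatrix_mem_unitaryGroup (hu : ∀ x, u x * star (u x) = 1) :
    monomialMatrix e u ∈ Matrix.unitaryGroup n ℂ := by
  rw [Matrix.mem_unitaryGroup_iff]
  ext x y
  have := monomialMatrix_conj_apply e u 1 x y
  rw [Matrix.mul_one] at this
  rw [Matrix.star_eq_conjTranspose, this]
  by_cases h : x = y
  · subst h; simpa using hu x
  · simp [h]

end Monomial

theorem sum_smul_stdAddChar_conj {p : ℕ} [NeZero p] (j j' : ZMod p) :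
    ∑ b : ZMod p, ZMod.stdAddChar (b * j) * star (ZMod.stdAddChar (b * j') : ℂ) =
      if j = j' then (p : ℂ) else 0 := by
  have h : ∀ b : ZMod p, ZMod.stdAddChar (b * j) * star (ZMod.stdAddChar (b * j') : ℂ) =
      ZMod.stdAddChar (b * (j - j')) := fun b => by
    rw [mul_sub, sub_eq_add_neg, AddChar.map_add_eq_mul, AddChar.map_neg_eq_conj]
    rfl
  simp_rw [h]
  rw [AddChar.sum_mulShift _ (ZMod.isPrimitive_stdAddChar p)]
  simp [sub_eq_zero]

theorem stdAddChar_mul_star {p : ℕ} [NeZero p] (j : ZMod p) :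
    ZMod.stdAddChar j * star (ZMod.stdAddChar j : ℂ) = 1 := by
  have := AddChar.map_neg_eq_conj (K := ℂ) (ZMod.stdAddChar (N := p)) j
  rw [show star (ZMod.stdAddChar j : ℂ) = ZMod.stdAddChar (-j) from this.symm,
    ← AddChar.map_add_eq_mul, add_neg_cancel, AddChar.map_zero_eq_one]

/-- The permutation `(i, j) ↦ (i + (j - i) l, j + (j - i) l)` which underlies `shear p l`. -/
def shearEquiv (p : ℕ) (l : ZMod p) : ZMod p × ZMod p ≃ ZMod p × ZMod p where
  toFun x := (x.1 + (x.2 - x.1) * l, x.2 + (x.2 - x.1) * l)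
  invFun x := (x.1 - (x.2 - x.1) * l, x.2 - (x.2 - x.1) * l)
  left_inv x := by ext <;> simp
  right_inv x := by ext <;> simp

/-- The permutation `(g, i, j) ↦ (g, shearEquiv p l (i, j + a))`. -/
def shearShiftEquiv (G : Type*) (p : ℕ) (l a : ZMod p) :
    G × (ZMod p × ZMod p) ≃ G × (ZMod p × ZMod p) :=
  (Equiv.refl G).prodCongr
    (((Equiv.refl (ZMod p)).prodCongr (Equiv.addRight a)).trans (shearEquiv p l))

section Shear

variable {G : Type*} {p : ℕ}

theorem one_kronecker_shear [DecidableEq G] (l : ZMod p) :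
    (1 : Matrix G G ℂ) ⊗ₖ shear p l = (monomialMatrix (shearShiftEquiv G p l 0) 1)ᴴ := by
  ext ⟨g, x⟩ ⟨g', y⟩
  by_cases hg : g = g' <;>
    simp [monomialMatrix, shear, shearShiftEquiv, shearEquiv, hg,
      apply_ite (starRingEnd ℂ)]

variable [NeZero p]

/-- The operator `ρ ⊗ μ` on `G F₁ F₂`. -/
noncomputable def tensorMixed (ρ : Matrix (G × ZMod p) (G × ZMod p) ℂ) :
    Matrix (G × (ZMod p × ZMod p)) (G × (ZMod p × ZMod p)) ℂ :=
  Matrix.reindex (Equiv.prodAssoc _ _ _) (Equiv.prodAssoc _ _ _) (ρ ⊗ₖ mixed (ZMod p))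

theorem tensorMixed_apply (ρ : Matrix (G × ZMod p) (G × ZMod p) ℂ)
    (x y : G × (ZMod p × ZMod p)) :
    tensorMixed ρ x y =
      if x.2.2 = y.2.2 then (p : ℂ)⁻¹ * ρ (x.1, x.2.1) (y.1, y.2.1) else 0 := by
  by_cases h : x.2.2 = y.2.2 <;> simp [tensorMixed, mixed, h, mul_comm, ZMod.card]

/-- A shear of parameter `s ≠ 0` decouples `F₁` once `F₂`, initially maximally mixed, is
discarded. -/
theorem sum_tensorMixed_shear [Fact p.Prime] (ρ : Matrix (G × ZMod p) (G × ZMod p) ℂ)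
    (s : ZMod p) (g g' : G) (i i' : ZMod p) :
    ∑ a : ZMod p, tensorMixed ρ (g, (i + (a - i) * s, a + (a - i) * s))
        (g', (i' + (a - i') * s, a + (a - i') * s)) =
      if s = 0 then ρ (g, i) (g', i')
      else (marginalLeft ρ ⊗ₖ mixed (ZMod p)) (g, i) (g', i') := by
  have hp : (p : ℂ) ≠ 0 := Nat.cast_ne_zero.2 (NeZero.ne p)
  simp_rw [tensorMixed_apply]
  split_ifs with hs
  · simp [hs, ZMod.card, hp]
  · have h (a : ZMod p) : a + (a - i) * s = a + (a - i') * s ↔ i = i' := by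
      rw [add_right_inj, mul_left_inj' hs, sub_right_inj]
    simp_rw [h]
    by_cases hi : i = i'
    · subst hi
      have e : ∑ a : ZMod p, ρ (g, i + (a - i) * s) (g', i + (a - i) * s) =
          ∑ c, ρ (g, c) (g', c) :=
        Fintype.sum_equiv (((Equiv.subRight i).trans (Equiv.mulRight₀ s hs)).trans
          (Equiv.addLeft i)) _ _ fun a => by simp
      simp [← Finset.mul_sum, e, marginalLeft, mixed, ZMod.card, mul_comm _ (p : ℂ)⁻¹]
    · simp [hi, mixed]

/-- Convex splitting with the shears `U_l`: if `ρ ≤ K₁ κ ⊗ μ` and `ρ_G ≤ r κ`, then the mixture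
of the `N` states `U_l (ρ ⊗ μ) U_l†` is as close to `κ ⊗ μ ⊗ μ` as `log (K₁ / N + (1 - 1/N) r)`. -/
theorem relEntropy_shear_le [Fintype G] [DecidableEq G] [Fact p.Prime]
    {ρ : Matrix (G × ZMod p) (G × ZMod p) ℂ}
    {κ : Matrix G G ℂ} (hρ : IsState ρ) (hκ : κ.PosSemidef) {K₁ r K : ℝ}
    (h₁ : Loewner ρ (K₁ • (κ ⊗ₖ mixed (ZMod p)))) (hr : Loewner (marginalLeft ρ) (r • κ))
    {S : Finset ℕ} (hS : S.Nonempty) (hinj : Set.InjOn (Nat.cast : ℕ → ZMod p) S)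
    (hK : K = (S.card : ℝ)⁻¹ * K₁ + (1 - (S.card : ℝ)⁻¹) * r) (hK1 : 1 ≤ K) :
    IsState ((S.card : ℝ)⁻¹ • ∑ l ∈ S, ((1 : Matrix G G ℂ) ⊗ₖ shear p (l : ZMod p)) *
        tensorMixed ρ * ((1 : Matrix G G ℂ) ⊗ₖ shear p (l : ZMod p))ᴴ) ∧
      relEntropy ((S.card : ℝ)⁻¹ • ∑ l ∈ S, ((1 : Matrix G G ℂ) ⊗ₖ shear p (l : ZMod p)) *
        tensorMixed ρ * ((1 : Matrix G G ℂ) ⊗ₖ shear p (l : ZMod p))ᴴ)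
        (κ ⊗ₖ (mixed (ZMod p) ⊗ₖ mixed (ZMod p))) ≤ ((Real.logb 2 K : ℝ) : EReal) := by
  have hp : (p : ℂ) ≠ 0 := Nat.cast_ne_zero.2 (NeZero.ne p)
  have hpR : (p : ℝ) ≠ 0 := Nat.cast_ne_zero.2 (NeZero.ne p)
  have hN : (S.card : ℝ) ≠ 0 := Nat.cast_ne_zero.2 hS.card_ne_zero
  set τ := (S.card : ℝ)⁻¹ • ∑ l ∈ S, ((1 : Matrix G G ℂ) ⊗ₖ shear p (l : ZMod p)) *
    tensorMixed ρ * ((1 : Matrix G G ℂ) ⊗ₖ shear p (l : ZMod p))ᴴ with hτ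
  set θ : Matrix (G × (ZMod p × ZMod p)) (G × (ZMod p × ZMod p)) ℂ :=
    κ ⊗ₖ (mixed (ZMod p) ⊗ₖ mixed (ZMod p)) with hθ
  have hmixed : (mixed (ZMod p)).PosSemidef := Matrix.PosSemidef.one.smul (by positivity)
  have hθpsd : θ.PosSemidef := hκ.kronecker (hmixed.kronecker hmixed)
  have hθ' : θ = tensorMixed (κ ⊗ₖ mixed (ZMod p)) := by
    ext ⟨g, i, j⟩ ⟨g', i', j'⟩
    simp [hθ, tensorMixed, mul_assoc]
  have hmono {A : Matrix (G × ZMod p) (G × ZMod p) ℂ} {c : ℝ}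
      (h : Loewner A (c • (κ ⊗ₖ mixed (ZMod p)))) : Loewner (tensorMixed A) (c • θ) := by
    have e : c • θ - tensorMixed A = tensorMixed (c • (κ ⊗ₖ mixed (ZMod p)) - A) := by
      rw [hθ']
      ext ⟨g, i, j⟩ ⟨g', i', j'⟩
      simp only [Matrix.sub_apply, Matrix.smul_apply, tensorMixed_apply]
      split_ifs <;> simp [mul_sub]
      ring
    rw [Loewner, e]
    exact (Matrix.PosSemidef.kronecker h hmixed).submatrix _
  -- the twirling unitaries: an inverse shear followed by a discrete Weyl operator on `F₂`
  let e (x : S × ZMod p × ZMod p) := shearShiftEquiv G p ((x.1 : ℕ) : ZMod p) x.2.1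
  let u (x : S × ZMod p × ZMod p) (y : G × (ZMod p × ZMod p)) : ℂ :=
    ZMod.stdAddChar (x.2.2 * y.2.2)
  have hu (x) (y) : u x y * star (u x y) = 1 := stdAddChar_mul_star _
  have hu' (x) (y z : G × (ZMod p × ZMod p)) (h : y.2.2 = z.2.2) :
      u x y * star (u x z) = 1 := by
    simp only [u, h]
    exact stdAddChar_mul_star _
  let W (x : S × ZMod p × ZMod p) :
      Matrix.unitaryGroup (G × (ZMod p × ZMod p)) ℂ :=
    ⟨monomialMatrix (e x) (u x), monomialMatrix_mem_unitaryGroup _ _ (hu x)⟩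
  let w (_ : S × ZMod p × ZMod p) : ℝ := (S.card : ℝ)⁻¹ * ((p : ℝ)⁻¹ * (p : ℝ)⁻¹)
  have hw1 : ∑ i, w i = 1 := by
    simp [w, ZMod.card]
    field_simp
  have hback (x) : (W x : Matrix _ _ ℂ)ᴴ * tensorMixed ρ * (W x : Matrix _ _ ℂ) =
      ((1 : Matrix G G ℂ) ⊗ₖ shear p ((x.1 : ℕ) : ZMod p)) * tensorMixed ρ *
        ((1 : Matrix G G ℂ) ⊗ₖ shear p ((x.1 : ℕ) : ZMod p))ᴴ := by
    ext ⟨g, i, j⟩ ⟨g', i', j'⟩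
    rw [one_kronecker_shear, Matrix.conjTranspose_conjTranspose]
    simp only [W, monomialMatrix_conj'_apply]
    simp only [e, u, shearShiftEquiv, Equiv.prodCongr_symm, Equiv.prodCongr_apply,
      Equiv.symm_trans_apply, Equiv.refl_symm, Equiv.refl_apply, Prod.map_apply,
      Prod.map_fst, Prod.map_snd, Equiv.addRight_symm, Equiv.coe_addRight, tensorMixed_apply,
      add_left_inj, neg_zero, add_zero, Pi.one_apply, star_one, one_mul, mul_one]
    split_ifs with h
    · rw [h, mul_right_comm, mul_comm (star _), stdAddChar_mul_star]
      simp
    · simp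
  have hfwd : ∑ x, w x • ((W x : Matrix _ _ ℂ) * τ * (W x : Matrix _ _ ℂ)ᴴ) =
      tensorMixed ((S.card : ℝ)⁻¹ • ρ +
        (1 - (S.card : ℝ)⁻¹) • (marginalLeft ρ ⊗ₖ mixed (ZMod p))) := by
    -- discarding `F₂` after the inverse shear gives the same operator for every `l ∈ S`:
    -- the term `l' = l` returns `ρ`, the others decouple
    have hτa (l : S) (g g' : G) (i i' : ZMod p) :
        ∑ a : ZMod p, τ (g, shearEquiv p ((l : ℕ) : ZMod p) (i, a))
          (g', shearEquiv p ((l : ℕ) : ZMod p) (i', a)) =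
        ((S.card : ℝ)⁻¹ • ρ + (1 - (S.card : ℝ)⁻¹) •
          (marginalLeft ρ ⊗ₖ mixed (ZMod p))) (g, i) (g', i') := by
      have h1 (l' : ℕ) (a : ZMod p) (g : G) (i : ZMod p) :
          (shearShiftEquiv G p (l' : ZMod p) 0).symm
            (g, shearEquiv p ((l : ℕ) : ZMod p) (i, a)) =
          (g, (i + (a - i) * ((l : ℕ) - l'), a + (a - i) * ((l : ℕ) - l'))) := by
        rw [Equiv.symm_apply_eq]
        simp only [shearShiftEquiv, shearEquiv, Equiv.prodCongr_apply, Equiv.coe_trans,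
          Equiv.coe_fn_mk, Prod.map_apply, Equiv.coe_refl, id, Function.comp_apply,
          Equiv.coe_addRight, add_zero, Prod.mk.injEq, true_and]
        constructor <;> ring
      have h2 (l' : ℕ) (hl' : l' ∈ S) : ((l : ℕ) : ZMod p) - l' = 0 ↔ (l : ℕ) = l' := by
        rw [sub_eq_zero]
        exact ⟨fun h => hinj l.2 hl' h, fun h => by rw [h]⟩
      simp only [hτ, Matrix.smul_apply, Matrix.sum_apply, one_kronecker_shear,
        Matrix.conjTranspose_conjTranspose, monomialMatrix_conj'_apply, h1, Pi.one_apply,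
        star_one, one_mul, mul_one, ← Finset.smul_sum, Matrix.add_apply]
      rw [Finset.sum_comm, Finset.sum_congr rfl fun (l' : ℕ) hl' =>
        (sum_tensorMixed_shear ρ (((l : ℕ) : ZMod p) - (l' : ZMod p)) g g' i i').trans
          (if_congr (h2 l' hl') rfl rfl),
        ← Finset.add_sum_erase _ _ l.2, if_pos rfl,
        Finset.sum_congr rfl fun l' hl' => if_neg (Finset.ne_of_mem_erase hl').symm,
        Finset.sum_const, Finset.card_erase_of_mem l.2, smul_add,
        ← Nat.cast_smul_eq_nsmul ℝ, smul_smul, Nat.cast_pred hS.card_pos, mul_sub,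
        inv_mul_cancel₀ hN, mul_one]
    ext ⟨g, i, j⟩ ⟨g', i', j'⟩
    have h3 (x : S × ZMod p × ZMod p) :
        (w x • ((W x).1 * τ * (W x).1ᴴ)) (g, i, j) (g', i', j') =
        ((w x : ℝ) : ℂ) * (ZMod.stdAddChar (x.2.2 * j) * star (ZMod.stdAddChar (x.2.2 * j') : ℂ)) *
          τ (g, shearEquiv p ((x.1 : ℕ) : ZMod p) (i, j + x.2.1))
            (g', shearEquiv p ((x.1 : ℕ) : ZMod p) (i', j' + x.2.1)) := by
      simp only [Matrix.smul_apply, W, monomialMatrix_conj_apply, e, u, Complex.real_smul]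
      simp only [shearShiftEquiv, Equiv.prodCongr_apply, Equiv.coe_trans, Prod.map_apply,
        Equiv.coe_refl, id, Function.comp_apply, Equiv.coe_addRight]
      ring
    -- the sum over the phases removes the off-diagonal blocks of `F₂`, and the sum over the
    -- shifts averages the diagonal ones
    rw [Matrix.sum_apply, Finset.sum_congr rfl fun x _ => h3 x]
    simp only [Fintype.sum_prod_type, w, ← Finset.sum_mul, ← Finset.mul_sum,
      sum_smul_stdAddChar_conj, tensorMixed_apply]
    split_ifs with hj
    · subst hj
      have h4 (l : S) := (Fintype.sum_equiv (Equiv.addLeft j) (fun a => τ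
        (g, shearEquiv p ((l : ℕ) : ZMod p) (i, j + a))
          (g', shearEquiv p ((l : ℕ) : ZMod p) (i', j + a))) _ fun a => rfl).trans
          (hτa l g g' i i')
      simp only [h4, Finset.sum_const, Finset.card_univ, Fintype.card_coe, nsmul_eq_mul]
      push_cast
      have hNC : (S.card : ℂ) ≠ 0 := Nat.cast_ne_zero.2 hS.card_ne_zero
      field_simp
    · simp
  refine relEntropy_le_of_twirl (w := w) (fun _ => by positivity) hw1 W (ρ := tensorMixed ρ)
    ⟨(hρ.1.kronecker hmixed).submatrix _, ?_⟩ hθpsd ?_ ?_ hK1 (hmono h₁) ?_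
  · have h : (mixed (ZMod p)).trace = 1 := by
      simp [mixed, Matrix.trace_smul, ZMod.card, hp]
    rw [tensorMixed, Matrix.trace]
    refine ((Equiv.prodAssoc G (ZMod p) (ZMod p)).symm.sum_comp fun x =>
      (ρ ⊗ₖ mixed (ZMod p)) x x).trans ?_
    exact (Matrix.trace_kronecker _ _).trans (by rw [hρ.2, h, one_mul])
  · simp only [hback, w, ← Finset.smul_sum, Fintype.sum_prod_type, Finset.sum_const,
      Finset.card_univ, Fintype.card_prod, ZMod.card, hτ]
    rw [← Finset.sum_coe_sort S]
    simp only [← Nat.cast_smul_eq_nsmul ℝ, smul_smul]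
    congr 1
    push_cast
    field_simp
  · intro x
    ext ⟨g, i, j⟩ ⟨g', i', j'⟩
    have h : (e x (g, i, j)).2 = (e x (g', i', j')).2 ↔ (i, j) = (i', j') := by
      simp [e, shearShiftEquiv]
    have hθa (y z : G × (ZMod p × ZMod p)) :
        θ y z = if y.2 = z.2 then κ y.1 z.1 * ((p : ℂ)⁻¹ * (p : ℂ)⁻¹) else 0 := by
      obtain ⟨g, i, j⟩ := y
      obtain ⟨g', i', j'⟩ := z
      by_cases hi : i = i' <;> by_cases hj : j = j' <;>
        simp [hθ, mixed, ZMod.card, hi, hj]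
    have h1 (y) : (e x y).1 = y.1 := rfl
    simp only [W, monomialMatrix_conj_apply, hθa, h, h1]
    split_ifs with hij
    · obtain ⟨rfl, rfl⟩ := Prod.mk.inj hij
      rw [mul_right_comm, hu' _ _ _ rfl, one_mul]
    · simp
  · rw [hfwd]
    refine hmono ?_
    have h : K • (κ ⊗ₖ mixed (ZMod p)) - ((S.card : ℝ)⁻¹ • ρ +
        (1 - (S.card : ℝ)⁻¹) • (marginalLeft ρ ⊗ₖ mixed (ZMod p))) =
        (S.card : ℝ)⁻¹ • (K₁ • (κ ⊗ₖ mixed (ZMod p)) - ρ) +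
        (1 - (S.card : ℝ)⁻¹) • ((r • κ - marginalLeft ρ) ⊗ₖ mixed (ZMod p)) := by
      have h' : (r • κ - marginalLeft ρ) ⊗ₖ mixed (ZMod p) =
          r • (κ ⊗ₖ mixed (ZMod p)) - marginalLeft ρ ⊗ₖ mixed (ZMod p) := by
        ext
        simp [sub_mul, mul_assoc]
      rw [hK, h']
      module
    rw [Loewner, h]
    refine (Matrix.PosSemidef.smul h₁ (by positivity)).add
      ((Matrix.PosSemidef.kronecker hr hmixed).smul ?_)
    exact sub_nonneg.2 (inv_le_one_of_one_le₀ (by exact_mod_cast hS.card_pos))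

end Shear

/-! ### The input state in the eigenbasis of the rounded state -/

section Coordinates

variable {R C : Type*} [Fintype R] [DecidableEq R] [Fintype C]

/-- `Ψ` in the eigenbasis of `C` given by the columns of `V`. -/
noncomputable def rotate (V : Matrix C C ℂ) (Ψ : Matrix (R × C) (R × C) ℂ) :
    Matrix (R × C) (R × C) ℂ :=
  ((1 : Matrix R R ℂ) ⊗ₖ V)ᴴ * Ψ * ((1 : Matrix R R ℂ) ⊗ₖ V)

variable [DecidableEq C]

/-- The block-diagonal form `∑_c |c⟩⟨c| ⊗ W_{m(c)}` of `flattener` in the eigenbasis, with the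
register `R` attached. -/
def blockFlattener (R : Type*) [DecidableEq R] {d : ℕ} (m : C → ℕ)
    (Wb : ℕ → Matrix (Fin d × Fin (maxMult m)) (Fin d × Fin (maxMult m)) ℂ) :
    Matrix ((R × C) × (Fin d × Fin (maxMult m))) ((R × C) × (Fin d × Fin (maxMult m))) ℂ :=
  Matrix.of fun x y => if x.1 = y.1 then Wb (m x.1.2) x.2 y.2 else 0

theorem rotate_flattener {d : ℕ} {V : Matrix C C ℂ} (hV : V ∈ Matrix.unitaryGroup C ℂ) (m : C → ℕ)
    (Wb : ℕ → Matrix (Fin d × Fin (maxMult m)) (Fin d × Fin (maxMult m)) ℂ) :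
    (((1 : Matrix R R ℂ) ⊗ₖ V) ⊗ₖ (1 : Matrix (Fin d × Fin (maxMult m)) _ ℂ))ᴴ *
      Matrix.reindex (Equiv.prodAssoc R C (Fin d × Fin (maxMult m))).symm
        (Equiv.prodAssoc R C (Fin d × Fin (maxMult m))).symm
        ((1 : Matrix R R ℂ) ⊗ₖ flattener V m Wb) =
    blockFlattener R m Wb *
      (((1 : Matrix R R ℂ) ⊗ₖ V) ⊗ₖ (1 : Matrix (Fin d × Fin (maxMult m)) _ ℂ))ᴴ := by
  have hVV (c c' : C) : ∑ i, star (V i c) * V i c' = if c = c' then 1 else 0 := by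
    have := congrFun (congrFun (Matrix.mem_unitaryGroup_iff'.1 hV) c) c'
    simpa [Matrix.mul_apply, Matrix.one_apply] using this
  ext ⟨⟨r, c⟩, z⟩ ⟨⟨r', c'⟩, z'⟩
  by_cases hr : r = r'
  · subst hr
    have : ∑ i, star (V i c) * flattener V m Wb (i, z) (c', z') =
        Wb (m c) z z' * star (V c' c) := by
      simp only [flattener, Matrix.sum_apply, Matrix.kronecker_apply, Matrix.vecMulVec_apply,
        Finset.mul_sum, Pi.star_apply]
      rw [Finset.sum_comm]
      simp only [← mul_assoc, ← Finset.sum_mul, hVV]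
      simp [mul_comm]
    simpa [Matrix.mul_apply, Fintype.sum_prod_type, blockFlattener, Matrix.one_apply,
      apply_ite (starRingEnd ℂ), Prod.ext_iff, ite_and] using this
  · simp [Matrix.mul_apply, Fintype.sum_prod_type, blockFlattener, Matrix.one_apply,
      apply_ite (starRingEnd ℂ), Prod.ext_iff, ite_and, hr, Ne.symm hr]

theorem rotate_flattened_apply {d n : ℕ} {V : Matrix C C ℂ} (hV : V ∈ Matrix.unitaryGroup C ℂ)
    (m : C → ℕ) (Wb : ℕ → Matrix (Fin d × Fin (maxMult m)) (Fin d × Fin (maxMult m)) ℂ)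
    (Ψ : Matrix (R × C) (R × C) ℂ) (r r' : R) (δ δ' : Fin d) (x x' : C × Fin (maxMult m)) :
    (((1 : Matrix (R × Fin d) (R × Fin d) ℂ) ⊗ₖ (V ⊗ₖ (1 : Matrix (Fin (maxMult m)) _ ℂ)))ᴴ *
      flattened n Ψ V m Wb *
      ((1 : Matrix (R × Fin d) (R × Fin d) ℂ) ⊗ₖ (V ⊗ₖ (1 : Matrix (Fin (maxMult m)) _ ℂ))))
        ((r, δ), x) ((r', δ'), x') =
      ∑ z : Fin d × Fin (maxMult m), Wb (m x.1) (δ, x.2) z *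
        (rotate V Ψ (r, x.1) (r', x'.1) *
          (xi (maxMult m) n d ⊗ₖ ketbraZero (maxMult m)) z z) *
        star (Wb (m x'.1) (δ', x'.2) z) := by
  set e := Equiv.prodProdProdComm R C (Fin d) (Fin (maxMult m))
  set B := ((1 : Matrix R R ℂ) ⊗ₖ V) ⊗ₖ
    (1 : Matrix (Fin d × Fin (maxMult m)) (Fin d × Fin (maxMult m)) ℂ) with hB
  set X := xi (maxMult m) n d ⊗ₖ ketbraZero (maxMult m) with hX
  have hXd : X = Matrix.diagonal fun z => X z z := by
    rw [hX, xi, ketbraZero, Matrix.diagonal_kronecker_diagonal]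
    simp
  have h1 : (1 : Matrix (R × Fin d) (R × Fin d) ℂ) ⊗ₖ
      (V ⊗ₖ (1 : Matrix (Fin (maxMult m)) (Fin (maxMult m)) ℂ)) = B.submatrix e.symm e.symm := by
    ext ⟨⟨r, δ⟩, c, x⟩ ⟨⟨r', δ'⟩, c', x'⟩
    by_cases hr : r = r' <;> by_cases hδ : δ = δ' <;> by_cases hx : x = x' <;>
      simp [hB, e, hr, hδ, hx]
  have h2 : Bᴴ * (Ψ ⊗ₖ X) * B = rotate V Ψ ⊗ₖ X := by
    rw [hB, Matrix.conjTranspose_kronecker, ← Matrix.mul_kronecker_mul,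
      ← Matrix.mul_kronecker_mul, rotate]
    simp
  set W := Matrix.reindex (Equiv.prodAssoc R C (Fin d × Fin (maxMult m))).symm
    (Equiv.prodAssoc R C (Fin d × Fin (maxMult m))).symm
    ((1 : Matrix R R ℂ) ⊗ₖ flattener V m Wb)
  have h3 : Bᴴ * W = blockFlattener R m Wb * Bᴴ := rotate_flattener hV m Wb
  have h4 : Bᴴ * (W * (Ψ ⊗ₖ X) * Wᴴ) * B =
      blockFlattener R m Wb * (rotate V Ψ ⊗ₖ X) * (blockFlattener R m Wb)ᴴ := by
    have h5 := congrArg Matrix.conjTranspose h3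
    rw [Matrix.conjTranspose_mul, Matrix.conjTranspose_mul, Matrix.conjTranspose_conjTranspose]
      at h5
    rw [Matrix.mul_assoc, Matrix.mul_assoc, h5, ← Matrix.mul_assoc, ← Matrix.mul_assoc,
      ← Matrix.mul_assoc, h3, ← h2]
    simp only [Matrix.mul_assoc]
  have h0 : flattened n Ψ V m Wb = (W * (Ψ ⊗ₖ X) * Wᴴ).submatrix e.symm e.symm := rfl
  rw [h1, h0, Matrix.conjTranspose_submatrix, Matrix.submatrix_mul_equiv,
    Matrix.submatrix_mul_equiv, h4, hXd]
  simp only [Matrix.submatrix_apply, Matrix.mul_apply, Matrix.kronecker_diagonal,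
    Matrix.conjTranspose_apply, blockFlattener, Matrix.of_apply,
    Fintype.sum_prod_type (α₁ := R × C)]
  simp [e, Matrix.blockDiagonal_apply, apply_ite (starRingEnd ℂ), mul_comm (X _ _)]

theorem rotate_flatState_apply {V : Matrix C C ℂ} (hV : V ∈ Matrix.unitaryGroup C ℂ) (γ : ℝ)
    (m : C → ℕ) (y y' : FlatIndex m) :
    ((V ⊗ₖ (1 : Matrix (Fin (maxMult m)) (Fin (maxMult m)) ℂ))ᴴ * flatState γ V m *
      (V ⊗ₖ (1 : Matrix (Fin (maxMult m)) (Fin (maxMult m)) ℂ))) y.1 y'.1 =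
      if y = y' then ((γ / Fintype.card C : ℝ) : ℂ) else 0 := by
  set B := V ⊗ₖ (1 : Matrix (Fin (maxMult m)) (Fin (maxMult m)) ℂ) with hB
  have hVV : Bᴴ * B = 1 := by
    rw [hB, Matrix.conjTranspose_kronecker, ← Matrix.mul_kronecker_mul]
    have := Matrix.mem_unitaryGroup_iff'.1 hV
    rw [Matrix.star_eq_conjTranspose] at this
    simp [this]
  have hket (x : FlatIndex m) : ketCE V x.1 = B *ᵥ Pi.single x.1 1 := by
    ext z
    simp [ketCE, hB, Matrix.one_apply]
  have h (x : FlatIndex m) : Bᴴ * Matrix.vecMulVec (ketCE V x.1) (star (ketCE V x.1)) * B =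
      Matrix.vecMulVec (Pi.single x.1 1) (Pi.single x.1 1) := by
    have h1 : star (ketCE V x.1) ᵥ* B = Pi.single x.1 1 := by
      rw [hket, Matrix.star_mulVec, Matrix.vecMul_vecMul, hVV, Matrix.vecMul_one]
      simp
    rw [Matrix.mul_vecMulVec, Matrix.vecMulVec_mul, h1, hket, Matrix.mulVec_mulVec, hVV,
      Matrix.one_mulVec]
  rw [flatState, Matrix.mul_smul, Matrix.smul_mul, Matrix.mul_sum, Matrix.sum_mul]
  simp only [h, Matrix.smul_apply, Matrix.sum_apply, Matrix.vecMulVec_apply]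
  by_cases hy : y = y'
  · subst hy
    simp [Pi.single_apply, Subtype.coe_inj]
  · have h2 (x : FlatIndex m) : (Pi.single x.1 1 : _ → ℂ) y.1 * (Pi.single x.1 1 : _ → ℂ) y'.1
        = 0 := by
      by_cases hx : x = y
      · subst hx
        simp [Subtype.coe_inj, Ne.symm hy]
      · simp [Pi.single_apply, Subtype.coe_inj, Ne.symm hx]
    simp [h2, hy]

theorem inputState_apply {d n p : ℕ} {γ : ℝ} {V : Matrix C C ℂ}
    (hV : V ∈ Matrix.unitaryGroup C ℂ) (Ψ : Matrix (R × C) (R × C) ℂ)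
    (m : C → ℕ) (Wb : ℕ → Matrix (Fin d × Fin (maxMult m)) (Fin d × Fin (maxMult m)) ℂ)
    (L : Labelling m p) (r r' : R) (δ δ' : Fin d) (f f' : ZMod p) :
    inputState γ n Ψ V m Wb L ((r, δ), f) ((r', δ'), f') =
      (∑ z : Fin d × Fin (maxMult m), Wb (m (L.toFun f).2.1.1.1) (δ, (L.toFun f).2.1.1.2) z *
        (rotate V Ψ (r, (L.toFun f).2.1.1.1) (r', (L.toFun f').2.1.1.1) *
          (xi (maxMult m) n d ⊗ₖ ketbraZero (maxMult m)) z z) *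
        star (Wb (m (L.toFun f').2.1.1.1) (δ', (L.toFun f').2.1.1.2) z)) *
      (if (L.toFun f).2.2 = (L.toFun f').2.2 then ((γ / Fintype.card C : ℝ) : ℂ) else 0) *
      ketbraZero 2 (L.toFun f).1 (L.toFun f').1 := by
  set B := V ⊗ₖ (1 : Matrix (Fin (maxMult m)) (Fin (maxMult m)) ℂ) with hB
  set sel : (R × Fin d) × ZMod p →
      ((R × Fin d) × (C × Fin (maxMult m))) × ((C × Fin (maxMult m)) × Fin 2) := fun u =>
    ((u.1, (L.toFun u.2).2.1.1), ((L.toFun u.2).2.2.1, (L.toFun u.2).1)) with hsel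
  set B' := ((1 : Matrix (R × Fin d) (R × Fin d) ℂ) ⊗ₖ B) ⊗ₖ
    (B ⊗ₖ (1 : Matrix (Fin 2) (Fin 2) ℂ)) with hB'
  set A := flattened n Ψ V m Wb ⊗ₖ (flatState γ V m ⊗ₖ ketbraZero 2) with hA
  have hJ : (1 : Matrix (R × Fin d) (R × Fin d) ℂ) ⊗ₖ L.embed V =
      B'.submatrix (Equiv.prodAssoc _ _ _).symm sel := by
    ext ⟨g, x, y, q⟩ ⟨g', f⟩
    simp [hB', hB, hsel, Labelling.embed, ketCE, Matrix.one_apply]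
  have h1 : inputState γ n Ψ V m Wb L = (B'ᴴ * A * B').submatrix sel sel := by
    have h2 : inputState γ n Ψ V m Wb L =
        (((1 : Matrix (R × Fin d) (R × Fin d) ℂ) ⊗ₖ L.embed V)ᴴ *
        A.submatrix (Equiv.prodAssoc _ _ _).symm (Equiv.prodAssoc _ _ _).symm *
        ((1 : Matrix (R × Fin d) (R × Fin d) ℂ) ⊗ₖ L.embed V)) := rfl
    rw [h2, hJ, Matrix.conjTranspose_submatrix, Matrix.submatrix_mul_equiv,
      Matrix.submatrix_mul_equiv]
  have h3 : B'ᴴ * A * B' = (((1 : Matrix (R × Fin d) (R × Fin d) ℂ) ⊗ₖ B)ᴴ *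
      flattened n Ψ V m Wb * ((1 : Matrix (R × Fin d) (R × Fin d) ℂ) ⊗ₖ B)) ⊗ₖ
      ((Bᴴ * flatState γ V m * B) ⊗ₖ ketbraZero 2) := by
    rw [hB', hA, Matrix.conjTranspose_kronecker, ← Matrix.mul_kronecker_mul,
      ← Matrix.mul_kronecker_mul, Matrix.conjTranspose_kronecker B, ← Matrix.mul_kronecker_mul,
      ← Matrix.mul_kronecker_mul]
    simp
  rw [h1, h3, Matrix.submatrix_apply, Matrix.kronecker_apply, Matrix.kronecker_apply,
    rotate_flatState_apply hV, ← mul_assoc]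
  congr 2
  exact rotate_flattened_apply hV m Wb Ψ r r' δ δ' _ _

end Coordinates

/-! ### The input state as the image of a completely positive map -/

/-- The eigenvalue of `ξ^{a:n}` at `|j+1⟩`. -/
noncomputable def xiCoeff (a n j : ℕ) : ℝ :=
  if a ≤ j + 1 ∧ j + 1 ≤ n then 1 / ((j + 1 : ℕ) : ℝ) / harmonicSum a n else 0

theorem xi_eq_diagonal (a n d : ℕ) :
    xi a n d = Matrix.diagonal fun j : Fin d => ((xiCoeff a n j : ℝ) : ℂ) := by
  rw [xi]
  congr 1
  ext j
  simp only [xiCoeff]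
  split_ifs <;> simp

theorem harmonicSum_nonneg (a n : ℕ) : 0 ≤ harmonicSum a n :=
  Finset.sum_nonneg fun _ _ => by positivity

theorem xiCoeff_nonneg (a n j : ℕ) : 0 ≤ xiCoeff a n j := by
  rw [xiCoeff]
  split_ifs
  · exact div_nonneg (by positivity) (harmonicSum_nonneg a n)
  · exact le_rfl

/-- The embezzling unitary `W_{m(c)}` takes `|j+1⟩|0⟩` to `|δ+1⟩|e⟩`, where `x = (c, e)`. -/
abbrev IsCell {C : Type*} [Fintype C] {m : C → ℕ} {d : ℕ} (j δ : Fin d) (x : FlatIndex m) : Prop :=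
  δ.val + 1 = (j.val + 1) / m x.1.1 ∧ x.1.2.val = (j.val + 1) % m x.1.1

theorem ketbraZero_two_apply (q q' : Fin 2) :
    ketbraZero 2 q q' = if q = 0 ∧ q' = 0 then 1 else 0 := by
  fin_cases q <;> fin_cases q' <;> simp [ketbraZero]

/-- Conjugation by the operator `K = ∑ₓ |x⟩⟨φ(x)|`, the sum being over the `x` which satisfy `c`. -/
theorem selection_conj_apply {u s : Type*} [Fintype s] [DecidableEq s] (φ : u → s) (c : u → Prop)
    [DecidablePred c] (Z : Matrix s s ℂ) (x y : u) :
    let K : Matrix u s ℂ := Matrix.of fun x i => if i = φ x ∧ c x then 1 else 0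
    (K * Z * Kᴴ) x y = if c x ∧ c y then Z (φ x) (φ y) else 0 := by
  by_cases hx : c x <;> by_cases hy : c y <;> simp [Matrix.mul_apply, hx, hy]

section Decode

variable {R C : Type*} [Fintype R] [DecidableEq R] [Fintype C] [DecidableEq C] {d p : ℕ}
  {m : C → ℕ}

/-- The operator `|r⟩|c⟩ ↦ |r⟩|δ+1⟩|0⟩_Q|c,e⟩|y⟩`, where `|δ+1⟩|e⟩` is the image of `|j+1⟩|0⟩` under
`W_{m(c)}`. It is a Kraus operator of the map which takes `Ψ` to the state on `R D F₁`. -/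
def kraus (R : Type*) [DecidableEq R] (L : Labelling m p) (j : Fin d) (y : FlatIndex m) :
    Matrix ((R × Fin d) × ZMod p) (R × C) ℂ :=
  Matrix.of fun u s =>
    if s = (u.1.1, (L.toFun u.2).2.1.1.1) ∧ (L.toFun u.2).1 = 0 ∧ (L.toFun u.2).2.2 = y ∧
      IsCell j u.1.2 (L.toFun u.2).2.1 then 1 else 0

/-- The completely positive map which takes `Ψ_{RC}`, written in the eigenbasis of `σ_C`, to
`W (Ψ_{RC} ⊗ |0⟩⟨0| ⊗ ξ^{a:n}) W† ⊗ |0⟩⟨0|_Q ⊗ σ_{C₁E₁}` on `R D F₁`. -/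
noncomputable def decode (γ : ℝ) (n : ℕ) (L : Labelling m p) (Z : Matrix (R × C) (R × C) ℂ) :
    Matrix ((R × Fin d) × ZMod p) ((R × Fin d) × ZMod p) ℂ :=
  ∑ j : Fin d, ∑ y : FlatIndex m, (xiCoeff (maxMult m) n j * (γ / Fintype.card C)) •
    (kraus R L j y * Z * (kraus R L j y)ᴴ)

theorem decode_apply (γ : ℝ) (n : ℕ) (L : Labelling m p) (Z : Matrix (R × C) (R × C) ℂ)
    (r r' : R) (δ δ' : Fin d) (f f' : ZMod p) :
    decode γ n L Z ((r, δ), f) ((r', δ'), f') =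
      if (L.toFun f).1 = 0 ∧ (L.toFun f').1 = 0 ∧ (L.toFun f).2.2 = (L.toFun f').2.2 then
        (((∑ j : Fin d, if IsCell j δ (L.toFun f).2.1 ∧ IsCell j δ' (L.toFun f').2.1
          then xiCoeff (maxMult m) n j else 0) * (γ / Fintype.card C) : ℝ) : ℂ) *
          Z (r, (L.toFun f).2.1.1.1) (r', (L.toFun f').2.1.1.1) else 0 := by
  have h (j : Fin d) (y : FlatIndex m) :
      (kraus R L j y * Z * (kraus R L j y)ᴴ) ((r, δ), f) ((r', δ'), f') =
      if (L.toFun f).2.2 = y then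
        if (L.toFun f).1 = 0 ∧ (L.toFun f').1 = 0 ∧ (L.toFun f).2.2 = (L.toFun f').2.2 then
          if IsCell j δ (L.toFun f).2.1 ∧ IsCell j δ' (L.toFun f').2.1 then
            Z (r, (L.toFun f).2.1.1.1) (r', (L.toFun f').2.1.1.1) else 0 else 0 else 0 := by
    simp only [← ite_and]
    refine (selection_conj_apply (fun u : (R × Fin d) × ZMod p =>
      (u.1.1, (L.toFun u.2).2.1.1.1)) (fun u => (L.toFun u.2).1 = 0 ∧ (L.toFun u.2).2.2 = y ∧
      IsCell j u.1.2 (L.toFun u.2).2.1) Z _ _).trans (if_congr ?_ rfl rfl)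
    constructor
    · rintro ⟨⟨h1, h2, h3⟩, h4, h5, h6⟩
      exact ⟨h2, ⟨h1, h4, h2.trans h5.symm⟩, h3, h6⟩
    · rintro ⟨h2, ⟨h1, h4, h5⟩, h3, h6⟩
      exact ⟨⟨h1, h2, h3⟩, h4, h5.symm.trans h2, h6⟩
  simp only [decode, Matrix.sum_apply, Matrix.smul_apply, h, Complex.real_smul]
  simp only [mul_ite, mul_zero, Finset.sum_ite_eq, Finset.mem_univ, if_true]
  split_ifs
  · push_cast
    rw [Finset.sum_mul, Finset.sum_mul]
    refine Finset.sum_congr rfl fun j _ => ?_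
    split_ifs <;> simp
  · simp

theorem inputState_eq_decode {n : ℕ} {γ : ℝ} {V : Matrix C C ℂ}
    (hV : V ∈ Matrix.unitaryGroup C ℂ) (Ψ : Matrix (R × C) (R × C) ℂ)
    {Wb : ℕ → Matrix (Fin d × Fin (maxMult m)) (Fin d × Fin (maxMult m)) ℂ}
    (hWb : ∀ b ≤ maxMult m, IsEmbezzler n b (Wb b)) (L : Labelling m p) :
    inputState γ n Ψ V m Wb L = decode γ n L (rotate V Ψ) := by
  have hpos (x : FlatIndex m) : 0 < m x.1.1 := (Nat.zero_le _).trans_lt x.2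
  have hle (x : FlatIndex m) : m x.1.1 ≤ maxMult m := Finset.le_sup (f := m) (Finset.mem_univ _)
  have hW (x : FlatIndex m) (δ j : Fin d) (e : Fin (maxMult m)) (he : e.val = 0)
      (hj : maxMult m ≤ j.val + 1 ∧ j.val + 1 ≤ n) :
      Wb (m x.1.1) (δ, x.1.2) (j, e) = if IsCell j δ x then 1 else 0 :=
    (hWb _ (hle x)).2 (hpos x) j e hj.1 hj.2 he δ x.1.2
  ext ⟨⟨r, δ⟩, f⟩ ⟨⟨r', δ'⟩, f'⟩
  have ha : 0 < maxMult m := (hpos (L.toFun f).2.1).trans_le (hle _)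
  have hsum : ∑ z : Fin d × Fin (maxMult m),
      Wb (m (L.toFun f).2.1.1.1) (δ, (L.toFun f).2.1.1.2) z *
        (rotate V Ψ (r, (L.toFun f).2.1.1.1) (r', (L.toFun f').2.1.1.1) *
          (xi (maxMult m) n d ⊗ₖ ketbraZero (maxMult m)) z z) *
        star (Wb (m (L.toFun f').2.1.1.1) (δ', (L.toFun f').2.1.1.2) z) =
      ((∑ j : Fin d, if IsCell j δ (L.toFun f).2.1 ∧ IsCell j δ' (L.toFun f').2.1
          then xiCoeff (maxMult m) n j else 0 : ℝ) : ℂ) *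
        rotate V Ψ (r, (L.toFun f).2.1.1.1) (r', (L.toFun f').2.1.1.1) := by
    rw [Fintype.sum_prod_type, Complex.ofReal_sum, Finset.sum_mul]
    refine Finset.sum_congr rfl fun j _ => ?_
    rw [Finset.sum_eq_single ⟨0, ha⟩]
    · have hx : (xi (maxMult m) n d ⊗ₖ ketbraZero (maxMult m)) (j, ⟨0, ha⟩) (j, ⟨0, ha⟩) =
          ((xiCoeff (maxMult m) n j : ℝ) : ℂ) := by
        rw [Matrix.kronecker_apply, xi_eq_diagonal]
        simp [ketbraZero]
      rw [hx]
      by_cases hj : maxMult m ≤ j.val + 1 ∧ j.val + 1 ≤ n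
      · rw [hW _ δ j _ rfl hj, hW _ δ' j _ rfl hj]
        by_cases h1 : IsCell j δ (L.toFun f).2.1
        · by_cases h2 : IsCell j δ' (L.toFun f').2.1
          · rw [if_pos h1, if_pos h2, if_pos ⟨h1, h2⟩]
            simp [mul_comm]
          · rw [if_neg h2, if_neg (show ¬(IsCell j δ _ ∧ IsCell j δ' _) from fun h => h2 h.2)]
            simp
        · rw [if_neg h1, if_neg (show ¬(IsCell j δ _ ∧ IsCell j δ' _) from fun h => h1 h.1)]
          simp
      · have : xiCoeff (maxMult m) n j = 0 := if_neg hj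
        simp [this]
    · intro e _ he
      have : e.val ≠ 0 := fun h => he (Fin.ext h)
      simp [ketbraZero, this]
    · simp
  rw [inputState_apply hV, hsum, decode_apply]
  rw [ketbraZero_two_apply]
  by_cases hq : (L.toFun f).1 = 0 ∧ (L.toFun f').1 = 0
  · rw [if_pos hq, mul_one]
    by_cases hy : (L.toFun f).2.2 = (L.toFun f').2.2
    · rw [if_pos hy, if_pos ⟨hq.1, hq.2, hy⟩, Complex.ofReal_mul]
      ring
    · rw [if_neg hy, if_neg fun h => hy h.2.2, mul_zero]
  · rw [if_neg hq, mul_zero, if_neg]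
    exact fun h => hq ⟨h.1, h.2.1⟩

end Decode

/-! ### The distribution produced by the embezzling unitary -/

theorem harmonicSum_pos {a n : ℕ} (ha : 0 < a) (h : a ≤ n) : 0 < harmonicSum a n :=
  Finset.sum_pos (fun j hj => by
    have : 0 < j := ha.trans_le (Finset.mem_Icc.1 hj).1
    positivity) ⟨a, Finset.mem_Icc.2 ⟨le_rfl, h⟩⟩

theorem sum_xiCoeff {a n d : ℕ} (ha : 0 < a) (han : a ≤ n) (hnd : n ≤ d) :
    ∑ j : Fin d, xiCoeff a n j = 1 := by
  have h : ∑ j : Fin d, xiCoeff a n j = (∑ j ∈ Finset.Icc a n, (1 : ℝ) / j) / harmonicSum a n := by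
    rw [Fin.sum_univ_eq_sum_range (fun j => xiCoeff a n j) d, Finset.sum_div]
    simp only [xiCoeff]
    rw [← Finset.sum_filter]
    refine Finset.sum_bij' (fun j _ => j + 1) (fun j _ => j - 1) ?_ ?_ ?_ ?_ ?_
    · simp
    · simp; omega
    · simp
    · simp; omega
    · simp
  rw [h]
  exact div_self (harmonicSum_pos ha han).ne'

section Cell

variable {C : Type*} [Fintype C] {m : C → ℕ} {d : ℕ}

theorem isCell_unique {j δ δ' : Fin d} {x x' : FlatIndex m} (h : IsCell j δ x)
    (h' : IsCell j δ' x') (hc : x.1.1 = x'.1.1) : δ = δ' ∧ x = x' := by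
  obtain ⟨h1, h2⟩ := h
  obtain ⟨h3, h4⟩ := h'
  rw [← hc] at h3 h4
  exact ⟨Fin.ext (by omega), Subtype.ext (Prod.ext hc (Fin.ext (h2.trans h4.symm)))⟩

/-- The probability with which the embezzling unitary leaves `D` in `|δ+1⟩` and `E` in `|e⟩`, given
that `C` is in the state `|c⟩`, where `x = (c, e)`. -/
noncomputable def cellWeight (n : ℕ) (δ : Fin d) (x : FlatIndex m) : ℝ :=
  ∑ j : Fin d, if IsCell j δ x then xiCoeff (maxMult m) n j else 0

theorem mult_pos (x : FlatIndex m) : 0 < m x.1.1 := (Nat.zero_le _).trans_lt x.2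

/-- Since `1/(j+1) ≤ 1/(b (δ+1))` for `δ + 1 = ⌊(j+1)/b⌋`, the embezzling unitary maps `ξ^{a:n}`
below `S(1,n)/S(a,n)` times the product of `ξ^{1:n}` and the uniform distribution on `b` points. -/
theorem cellWeight_le (n : ℕ) (δ : Fin d) (x : FlatIndex m) :
    cellWeight n δ x ≤ (harmonicSum 1 n / harmonicSum (maxMult m) n) * xiCoeff 1 n δ /
      m x.1.1 := by
  have hb := mult_pos x
  set b := m x.1.1
  set B := (harmonicSum 1 n / harmonicSum (maxMult m) n) * xiCoeff 1 n δ / b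
  have hB : 0 ≤ B := div_nonneg (mul_nonneg (div_nonneg (harmonicSum_nonneg _ _)
    (harmonicSum_nonneg _ _)) (xiCoeff_nonneg _ _ _)) (Nat.cast_nonneg _)
  have hterm (j : Fin d) : (if IsCell j δ x then xiCoeff (maxMult m) n j else 0) ≤
      if j.val + 1 = b * (δ.val + 1) + x.1.2.val then B else 0 := by
    by_cases hj : IsCell j δ x
    · have hj1 : j.val + 1 = b * (δ.val + 1) + x.1.2.val := by
        rw [hj.1, hj.2]
        exact (Nat.div_add_mod _ _).symm
      rw [if_pos hj, if_pos hj1, xiCoeff]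
      split_ifs with h
      · have hle : b * (δ.val + 1) ≤ j.val + 1 := by omega
        have hδn : δ.val + 1 ≤ n := by nlinarith
        have h1 : 0 < harmonicSum 1 n := harmonicSum_pos one_pos (by omega)
        have hxi : xiCoeff 1 n δ = 1 / ((δ.val + 1 : ℕ) : ℝ) / harmonicSum 1 n :=
          if_pos ⟨by omega, hδn⟩
        have hB' : B = 1 / ((b * (δ.val + 1) : ℕ) : ℝ) / harmonicSum (maxMult m) n := by
          simp only [B, hxi]
          push_cast
          field_simp
        rw [hB']
        refine div_le_div_of_nonneg_right ?_ (harmonicSum_nonneg _ _)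
        exact one_div_le_one_div_of_le (by positivity) (by exact_mod_cast hle)
      · exact hB
    · rw [if_neg hj]
      split_ifs
      · exact hB
      · exact le_rfl
  refine (Finset.sum_le_sum fun j _ => hterm j).trans ?_
  rw [← Finset.sum_filter, Finset.sum_const, nsmul_eq_mul]
  have hcard : (Finset.univ.filter fun j : Fin d =>
      j.val + 1 = b * (δ.val + 1) + x.1.2.val).card ≤ 1 := by
    rw [Finset.card_le_one]
    intro i hi j hj
    simp only [Finset.mem_filter, Finset.mem_univ, true_and] at hi hj
    exact Fin.ext (by omega)
  exact mul_le_of_le_one_left hB (by exact_mod_cast hcard)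

theorem card_flatIndex_fiber [DecidableEq C] (c : C) :
    (Finset.univ.filter fun x : FlatIndex m => x.1.1 = c).card = m c := by
  have hle : m c ≤ maxMult m := Finset.le_sup (f := m) (Finset.mem_univ c)
  rw [← Fintype.card_fin (m c), ← Finset.card_univ]
  refine (Finset.card_bij (fun e _ => ⟨(c, ⟨e.val, e.2.trans_le hle⟩), e.2⟩) ?_ ?_ ?_).symm
  · simp
  · intro e _ e' _ h
    simpa [Fin.ext_iff] using h
  · rintro ⟨⟨c', e⟩, he⟩ hx
    simp only [Finset.mem_filter, Finset.mem_univ, true_and] at hx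
    subst hx
    exact ⟨⟨e.val, he⟩, Finset.mem_univ _, rfl⟩

theorem card_flatIndex : Fintype.card (FlatIndex m) = ∑ c, m c := by
  classical
  rw [← Finset.card_univ, Finset.card_eq_sum_card_fiberwise (f := fun x : FlatIndex m => x.1.1)
    (t := Finset.univ) (fun _ _ => Finset.mem_coe.2 (Finset.mem_univ _))]
  exact Finset.sum_congr rfl fun c _ => card_flatIndex_fiber c

theorem sum_cellWeight_le [DecidableEq C] (n : ℕ) (δ : Fin d) (c : C) :
    ∑ x : FlatIndex m with x.1.1 = c, cellWeight n δ x ≤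
      (harmonicSum 1 n / harmonicSum (maxMult m) n) * xiCoeff 1 n δ := by
  have hB : 0 ≤ (harmonicSum 1 n / harmonicSum (maxMult m) n) * xiCoeff 1 n δ :=
    mul_nonneg (div_nonneg (harmonicSum_nonneg _ _) (harmonicSum_nonneg _ _)) (xiCoeff_nonneg _ _ _)
  refine (Finset.sum_le_card_nsmul _ _ ((harmonicSum 1 n / harmonicSum (maxMult m) n) *
    xiCoeff 1 n δ / m c) fun x hx => ?_).trans ?_
  · have := cellWeight_le n δ x
    rwa [(Finset.mem_filter.1 hx).2] at this
  · rw [card_flatIndex_fiber, nsmul_eq_mul]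
    by_cases hc : (m c : ℝ) = 0
    · rw [hc, zero_mul]
      exact hB
    · rw [mul_div_cancel₀ _ hc]

theorem sum_sum_cellWeight [DecidableEq C] {n : ℕ} (han : maxMult m ≤ n) (hnd : n ≤ d) {c : C}
    (hc : 0 < m c) :
    ∑ δ : Fin d, ∑ x : FlatIndex m with x.1.1 = c, cellWeight n δ x = 1 := by
  have hle : m c ≤ maxMult m := Finset.le_sup (f := m) (Finset.mem_univ c)
  rw [← sum_xiCoeff (hc.trans_le hle) han hnd]
  simp only [cellWeight]
  rw [← Finset.sum_product', Finset.sum_comm]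
  refine Finset.sum_congr rfl fun j _ => ?_
  by_cases hj : maxMult m ≤ j.val + 1 ∧ j.val + 1 ≤ n
  · have hdiv : 0 < (j.val + 1) / m c := Nat.div_pos (hle.trans hj.1) hc
    have hdiv' : (j.val + 1) / m c ≤ j.val + 1 := Nat.div_le_self _ _
    have hmod : (j.val + 1) % m c < m c := Nat.mod_lt _ hc
    rw [Finset.sum_eq_single ((⟨(j.val + 1) / m c - 1, by omega⟩ : Fin d),
      (⟨(c, ⟨(j.val + 1) % m c, hmod.trans_le hle⟩), hmod⟩ : FlatIndex m))]
    · rw [if_pos]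
      exact ⟨Nat.sub_add_cancel hdiv, rfl⟩
    · rintro ⟨δ, ⟨⟨c', e⟩, he⟩⟩ hx hne
      simp only [Finset.mem_product, Finset.mem_filter, Finset.mem_univ, true_and] at hx
      subst hx
      rw [if_neg]
      rintro ⟨h1, h2⟩
      refine hne (Prod.ext (Fin.ext ?_) (Subtype.ext (Prod.ext rfl (Fin.ext h2))))
      simp only at h1 ⊢
      omega
    · intro h
      exact absurd (by simp) h
  · have : xiCoeff (maxMult m) n j = 0 := if_neg hj
    simp [this]

end Cell

/-! ### Bounds on the decoded state -/

section DecodeBounds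

variable {R C : Type*} [Fintype R] [DecidableEq R] [Fintype C] [DecidableEq C] {d p : ℕ}
  {m : C → ℕ} {γ : ℝ} {n : ℕ}

theorem decode_smul (L : Labelling m p) (K : ℝ) (Z : Matrix (R × C) (R × C) ℂ) :
    decode (d := d) γ n L (K • Z) = K • decode γ n L Z := by
  simp only [decode, Matrix.mul_smul, Matrix.smul_mul, smul_comm _ K, ← Finset.smul_sum]

/-- If `C` is in the rounded state, uncorrelated with `R`, then the decoded state is diagonal in the
registers `D F₁`. -/
theorem decode_kronecker_diagonal (L : Labelling m p) (A : Matrix R R ℂ) :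
    decode (d := d) γ n L
      (A ⊗ₖ Matrix.diagonal fun c => (((m c : ℝ) * (γ / Fintype.card C) : ℝ) : ℂ)) =
    (A ⊗ₖ Matrix.diagonal fun u : Fin d × ZMod p => ((if (L.toFun u.2).1 = 0 then
      cellWeight n u.1 (L.toFun u.2).2.1 * m (L.toFun u.2).2.1.1.1 * (γ / Fintype.card C) ^ 2
      else 0 : ℝ) : ℂ)).submatrix (Equiv.prodAssoc _ _ _) (Equiv.prodAssoc _ _ _) := by
  ext ⟨⟨r, δ⟩, f⟩ ⟨⟨r', δ'⟩, f'⟩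
  rw [decode_apply]
  simp only [Matrix.submatrix_apply, Equiv.prodAssoc_apply, Matrix.kronecker_apply]
  by_cases h : (δ, f) = (δ', f')
  · obtain ⟨rfl, rfl⟩ := Prod.mk.inj h
    simp only [Matrix.diagonal_apply_eq, and_self, and_true]
    split_ifs
    · rw [cellWeight]
      push_cast
      ring
    · simp
  · rw [Matrix.diagonal_apply_ne _ h, mul_zero]
    split_ifs with hq
    · by_cases hc : (L.toFun f).2.1.1.1 = (L.toFun f').2.1.1.1
      · have h0 (j : Fin d) :
            ¬(IsCell j δ (L.toFun f).2.1 ∧ IsCell j δ' (L.toFun f').2.1) := fun hj => by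
          obtain ⟨h1, h2⟩ := isCell_unique hj.1 hj.2 hc
          refine h (Prod.ext h1 (L.injective ?_))
          exact Prod.ext (hq.1.trans hq.2.1.symm) (Prod.ext h2 hq.2.2)
        simp only [h0, if_false, Finset.sum_const_zero, zero_mul, Complex.ofReal_zero]
      · rw [Matrix.diagonal_apply_ne _ hc, mul_zero, mul_zero]
    · rfl

variable [NeZero p]

theorem decode_posSemidef (hγ : 0 ≤ γ) (L : Labelling m p) {Z : Matrix (R × C) (R × C) ℂ}
    (hZ : Z.PosSemidef) : (decode (d := d) γ n L Z).PosSemidef :=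
  Matrix.posSemidef_sum _ fun _ _ => Matrix.posSemidef_sum _ fun _ _ =>
    (hZ.mul_mul_conjTranspose_same _).smul
      (mul_nonneg (xiCoeff_nonneg _ _ _) (div_nonneg hγ (Nat.cast_nonneg _)))

theorem decode_mono (hγ : 0 ≤ γ) (L : Labelling m p) {Z Z' : Matrix (R × C) (R × C) ℂ}
    (h : Loewner Z Z') : Loewner (decode (d := d) γ n L Z) (decode γ n L Z') := by
  have : decode (d := d) γ n L Z' - decode γ n L Z = decode γ n L (Z' - Z) := by
    simp only [decode, Matrix.mul_sub, Matrix.sub_mul, smul_sub, Finset.sum_sub_distrib]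
  rw [Loewner, this]
  exact decode_posSemidef hγ L h

theorem decode_kronecker_diagonal_le (L : Labelling m p) {A : Matrix R R ℂ}
    (hA : A.PosSemidef) (hp : (γ / Fintype.card C) ^ 2 ≤ 2 / p) :
    Loewner (decode (d := d) γ n L
      (A ⊗ₖ Matrix.diagonal fun c => (((m c : ℝ) * (γ / Fintype.card C) : ℝ) : ℂ)))
      ((2 * (harmonicSum 1 n / harmonicSum (maxMult m) n)) •
        ((A ⊗ₖ xi 1 n d) ⊗ₖ mixed (ZMod p))) := by
  set ratio := harmonicSum 1 n / harmonicSum (maxMult m) n with hratio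
  have hr : 0 ≤ ratio := div_nonneg (harmonicSum_nonneg _ _) (harmonicSum_nonneg _ _)
  have hpp : (0 : ℝ) < p := Nat.cast_pos.2 (NeZero.pos p)
  set g : Fin d × ZMod p → ℝ := fun u => if (L.toFun u.2).1 = 0 then
      cellWeight n u.1 (L.toFun u.2).2.1 * m (L.toFun u.2).2.1.1.1 * (γ / Fintype.card C) ^ 2
      else 0 with hg
  have hle (u : Fin d × ZMod p) : g u ≤ 2 * ratio * (xiCoeff 1 n u.1 * (p : ℝ)⁻¹) := by
    have h0 : 0 ≤ ratio * xiCoeff 1 n u.1 := mul_nonneg hr (xiCoeff_nonneg _ _ _)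
    simp only [hg]
    split_ifs
    · have hm : (0 : ℝ) < m (L.toFun u.2).2.1.1.1 := Nat.cast_pos.2 (mult_pos _)
      have h1 := (le_div_iff₀ hm).1 (cellWeight_le n u.1 (L.toFun u.2).2.1)
      refine (mul_le_mul h1 hp (sq_nonneg _) h0).trans_eq ?_
      rw [div_eq_mul_inv]
      ring
    · have := inv_nonneg.2 hpp.le
      nlinarith [mul_nonneg h0 this]
  have : (2 * ratio) • ((A ⊗ₖ xi 1 n d) ⊗ₖ mixed (ZMod p)) - decode (d := d) γ n L
      (A ⊗ₖ Matrix.diagonal fun c => (((m c : ℝ) * (γ / Fintype.card C) : ℝ) : ℂ)) =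
      (A ⊗ₖ Matrix.diagonal fun u : Fin d × ZMod p =>
        ((2 * ratio * (xiCoeff 1 n u.1 * (p : ℝ)⁻¹) - g u : ℝ) : ℂ)).submatrix
        (Equiv.prodAssoc _ _ _) (Equiv.prodAssoc _ _ _) := by
    rw [decode_kronecker_diagonal, xi_eq_diagonal]
    ext ⟨⟨r, δ⟩, f⟩ ⟨⟨r', δ'⟩, f'⟩
    by_cases h : (δ, f) = (δ', f')
    · obtain ⟨rfl, rfl⟩ := Prod.mk.inj h
      simp [mixed, ZMod.card, hg]
      ring
    · have h' : ¬(δ = δ' ∧ f = f') := fun h' => h (Prod.ext h'.1 h'.2)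
      rw [not_and_or] at h'
      rcases h' with h' | h' <;> simp [mixed, h']
  rw [Loewner, this]
  refine (hA.kronecker (Matrix.PosSemidef.diagonal fun u => ?_)).submatrix _
  exact Complex.zero_le_real.2 (sub_nonneg.2 (hle u))

theorem Labelling.sum_eq {α : Type*} [AddCommMonoid α] (L : Labelling m p)
    (F : Fin 2 × FlatIndex m × FlatIndex m → α) (hF : ∀ u, u.1 ≠ 0 → F u = 0) :
    ∑ f, F (L.toFun f) = ∑ x : FlatIndex m, ∑ y : FlatIndex m, F (0, x, y) := by
  classical
  have h1 : ∑ f, F (L.toFun f) = ∑ u, F u := by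
    rw [← Finset.sum_image (s := Finset.univ) (g := L.toFun) (f := F) L.injective.injOn]
    refine Finset.sum_subset (Finset.subset_univ _) fun u _ hu => hF u fun h0 => hu ?_
    obtain ⟨i, hi⟩ := L.covers u.2.1 u.2.2
    exact Finset.mem_image.2 ⟨i, Finset.mem_univ _, hi.trans (Prod.ext h0.symm rfl)⟩
  rw [h1, Fintype.sum_prod_type, Finset.sum_eq_single 0, Fintype.sum_prod_type]
  · exact fun q _ hq => Finset.sum_eq_zero fun u _ => hF _ hq
  · simp

/-- Discarding `F₁` leaves `∑_c ⟨c|Z|c⟩ ⊗ ξ_c`, where `ξ_c` is diagonal and is the state of `D`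
conditioned on `c`; it is zero if `m(c) = 0`. -/
theorem marginalLeft_decode_apply (L : Labelling m p) (Z : Matrix (R × C) (R × C) ℂ)
    (hM : Fintype.card (FlatIndex m) * (γ / Fintype.card C) = 1) (r r' : R) (δ δ' : Fin d) :
    marginalLeft (decode γ n L Z) (r, δ) (r', δ') =
      if δ = δ' then ∑ c, ((∑ x : FlatIndex m with x.1.1 = c, cellWeight n δ x : ℝ) : ℂ) *
        Z (r, c) (r', c) else 0 := by
  let F (u : Fin 2 × FlatIndex m × FlatIndex m) : ℂ := if u.1 = 0 then
    ((if δ = δ' then cellWeight n δ u.2.1 * (γ / Fintype.card C) else 0 : ℝ) : ℂ) *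
      Z (r, u.2.1.1.1) (r', u.2.1.1.1) else 0
  have h1 (f : ZMod p) : decode γ n L Z ((r, δ), f) ((r', δ'), f) = F (L.toFun f) := by
    rw [decode_apply]
    simp only [and_true, F]
    refine if_congr (by simp) ?_ rfl
    congr 2
    by_cases hδ : δ = δ'
    · subst hδ
      simp only [and_self, if_true, cellWeight]
    · have h0 (j : Fin d) :
          ¬(IsCell j δ (L.toFun f).2.1 ∧ IsCell j δ' (L.toFun f).2.1) := fun hj =>
        hδ (isCell_unique hj.1 hj.2 rfl).1
      simp only [h0, if_false, Finset.sum_const_zero, zero_mul, hδ]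
  rw [marginalLeft, Matrix.of_apply, Finset.sum_congr rfl fun f _ => h1 f,
    L.sum_eq F fun u hu => if_neg hu]
  simp only [F, if_true, Finset.sum_const, Finset.card_univ, nsmul_eq_mul]
  by_cases hδ : δ = δ'
  · simp only [hδ, if_true]
    rw [← Finset.sum_fiberwise (s := Finset.univ) (g := fun x : FlatIndex m => x.1.1)]
    refine Finset.sum_congr rfl fun c _ => ?_
    rw [Complex.ofReal_sum, Finset.sum_mul]
    refine Finset.sum_congr rfl fun x hx => ?_
    rw [(Finset.mem_filter.1 hx).2, ← mul_assoc]
    congr 1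
    have : ((Fintype.card (FlatIndex m) : ℕ) : ℂ) * ((γ / Fintype.card C : ℝ) : ℂ) = 1 := by
      exact_mod_cast hM
    rw [Complex.ofReal_mul, mul_left_comm, this, mul_one]
  · simp [hδ]

theorem marginalLeft_decode_le (L : Labelling m p) {Z : Matrix (R × C) (R × C) ℂ}
    (hZ : Z.PosSemidef) (hM : Fintype.card (FlatIndex m) * (γ / Fintype.card C) = 1) :
    Loewner (marginalLeft (decode (d := d) γ n L Z))
      ((harmonicSum 1 n / harmonicSum (maxMult m) n) • (marginalLeft Z ⊗ₖ xi 1 n d)) := by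
  have : (harmonicSum 1 n / harmonicSum (maxMult m) n) • (marginalLeft Z ⊗ₖ xi 1 n d) -
      marginalLeft (decode (d := d) γ n L Z) =
      ∑ c, Z.submatrix (fun r => (r, c)) (fun r => (r, c)) ⊗ₖ Matrix.diagonal fun δ : Fin d =>
        (((harmonicSum 1 n / harmonicSum (maxMult m) n) * xiCoeff 1 n δ -
          ∑ x : FlatIndex m with x.1.1 = c, cellWeight n δ x : ℝ) : ℂ) := by
    ext ⟨r, δ⟩ ⟨r', δ'⟩
    rw [Matrix.sub_apply, marginalLeft_decode_apply L Z hM, Matrix.sum_apply, xi_eq_diagonal]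
    by_cases hδ : δ = δ'
    · subst hδ
      simp only [marginalLeft, Matrix.smul_apply, Matrix.kronecker_apply, Matrix.of_apply,
        Matrix.diagonal_apply_eq, if_true, Complex.real_smul, Finset.sum_mul, Finset.mul_sum,
        Matrix.submatrix_apply]
      rw [← Finset.sum_sub_distrib]
      refine Finset.sum_congr rfl fun c _ => ?_
      push_cast
      ring
    · simp [hδ]
  rw [Loewner, this]
  refine Matrix.posSemidef_sum _ fun c _ => (hZ.submatrix _).kronecker
    (Matrix.PosSemidef.diagonal fun δ => ?_)
  exact Complex.zero_le_real.2 (sub_nonneg.2 (sum_cellWeight_le n δ c))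

theorem trace_marginalLeft {α β : Type*} [Fintype α] [Fintype β]
    (Z : Matrix (α × β) (α × β) ℂ) : (marginalLeft Z).trace = Z.trace := by
  simp [Matrix.trace, marginalLeft, Fintype.sum_prod_type]

/-- The decoding map preserves the trace on operators which vanish on the kernel of `σ_C`, whose
basis vectors are the `|c⟩` with `m(c) = 0`. -/
theorem trace_decode (L : Labelling m p) {Z : Matrix (R × C) (R × C) ℂ}
    (hM : Fintype.card (FlatIndex m) * (γ / Fintype.card C) = 1)
    (hZ : ∀ r c, m c = 0 → Z (r, c) (r, c) = 0) (han : maxMult m ≤ n) (hnd : n ≤ d) :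
    (decode (d := d) γ n L Z).trace = Z.trace := by
  rw [← trace_marginalLeft, Matrix.trace, Matrix.trace, Fintype.sum_prod_type,
    Fintype.sum_prod_type]
  refine Finset.sum_congr rfl fun r _ => ?_
  simp only [Matrix.diag_apply, marginalLeft_decode_apply L Z hM, if_true]
  rw [Finset.sum_comm]
  refine Finset.sum_congr rfl fun c _ => ?_
  rw [← Finset.sum_mul, ← Complex.ofReal_sum]
  rcases Nat.eq_zero_or_pos (m c) with hc | hc
  · rw [hZ r c hc, mul_zero]
  · rw [sum_sum_cellWeight han hnd hc, Complex.ofReal_one, one_mul]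

end DecodeBounds

/-! ### Change of basis on `C` -/

section Rotate

variable {R C : Type*} [Fintype R] [DecidableEq R] [Fintype C] {V : Matrix C C ℂ}

theorem rotate_isState [DecidableEq C] (hV : V ∈ Matrix.unitaryGroup C ℂ)
    {Ψ : Matrix (R × C) (R × C) ℂ} (hΨ : IsState Ψ) : IsState (rotate V Ψ) := by
  refine ⟨hΨ.1.conjTranspose_mul_mul_same _, ?_⟩
  rw [rotate, Matrix.trace_mul_comm, ← Matrix.mul_assoc, Matrix.conjTranspose_kronecker,
    ← Matrix.mul_kronecker_mul, ← Matrix.star_eq_conjTranspose V, Matrix.mem_unitaryGroup_iff.1 hV]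
  simp [hΨ.2]

theorem marginalLeft_rotate [DecidableEq C] (hV : V ∈ Matrix.unitaryGroup C ℂ)
    (Ψ : Matrix (R × C) (R × C) ℂ) :
    marginalLeft (rotate V Ψ) = marginalLeft Ψ := by
  have hVV : V * Vᴴ = 1 := Matrix.mem_unitaryGroup_iff.1 hV
  ext r r'
  have h (c c' : C) : rotate V Ψ (r, c) (r', c') =
      (Vᴴ * Ψ.submatrix (fun c => (r, c)) (fun c => (r', c)) * V) c c' := by
    simp [rotate, Matrix.mul_apply, Fintype.sum_prod_type, Matrix.one_apply,
      apply_ite (starRingEnd ℂ)]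
  have h2 : (Vᴴ * Ψ.submatrix (fun c => (r, c)) (fun c => (r', c)) * V).trace =
      (Ψ.submatrix (fun c => (r, c)) (fun c => (r', c))).trace := by
    rw [Matrix.trace_mul_comm, ← Matrix.mul_assoc, hVV, Matrix.one_mul]
  simp only [marginalLeft, Matrix.of_apply, h]
  exact h2

theorem rotate_kronecker (A : Matrix R R ℂ) (B : Matrix C C ℂ) :
    rotate V (A ⊗ₖ B) = A ⊗ₖ (Vᴴ * B * V) := by
  rw [rotate, Matrix.conjTranspose_kronecker, ← Matrix.mul_kronecker_mul,
    ← Matrix.mul_kronecker_mul]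
  simp

theorem rotate_mono {Z Z' : Matrix (R × C) (R × C) ℂ} (h : Loewner Z Z') :
    Loewner (rotate V Z) (rotate V Z') := by
  have : rotate V Z' - rotate V Z = rotate V (Z' - Z) := by
    simp only [rotate, Matrix.mul_sub, Matrix.sub_mul]
  rw [Loewner, this]
  exact Matrix.PosSemidef.conjTranspose_mul_mul_same h _

end Rotate

/-! ### The Loewner order and the max-relative entropy -/

theorem Loewner.trans {ι : Type*} [Fintype ι] {A B D : Matrix ι ι ℂ} (h₁ : Loewner A B)
    (h₂ : Loewner B D) : Loewner A D := by
  have : D - A = (D - B) + (B - A) := by abel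
  rw [Loewner, this]
  exact Matrix.PosSemidef.add h₂ h₁

theorem Loewner.smul {ι : Type*} [Fintype ι] {A B : Matrix ι ι ℂ} (h : Loewner A B) {K : ℝ}
    (hK : 0 ≤ K) : Loewner (K • A) (K • B) := by
  rw [Loewner, ← smul_sub]
  exact Matrix.PosSemidef.smul h hK

theorem Loewner.kronecker_right {ι κ : Type*} [Fintype ι] [Fintype κ] {A : Matrix ι ι ℂ}
    (hA : A.PosSemidef) {B B' : Matrix κ κ ℂ} (h : Loewner B B') :
    Loewner (A ⊗ₖ B) (A ⊗ₖ B') := by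
  have : A ⊗ₖ B' - A ⊗ₖ B = A ⊗ₖ (B' - B) := by
    ext
    simp [mul_sub]
  rw [Loewner, this]
  exact hA.kronecker h

/-- The infimum in the definition of the max-relative entropy is attained when it is finite. -/
theorem loewner_of_dmax_eq {ι : Type*} [Fintype ι] {ρ σ : Matrix ι ι ℂ} (hρ : ρ.IsHermitian)
    (hσ : σ.PosSemidef) {k : ℝ} (hk : dmax ρ σ = (k : EReal)) :
    Loewner ρ (((2 : ℝ) ^ k) • σ) := by
  have hgt (l : ℝ) (hl : k < l) : Loewner ρ (((2 : ℝ) ^ l) • σ) := by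
    have h : dmax ρ σ < (l : EReal) := by rw [hk]; exact_mod_cast hl
    obtain ⟨_, ⟨l', hl', rfl⟩, hlt⟩ := sInf_lt_iff.1 h
    refine Loewner.trans hl' ?_
    rw [Loewner, ← sub_smul]
    refine hσ.smul (sub_nonneg.2 (Real.rpow_le_rpow_of_exponent_le one_le_two ?_))
    exact EReal.coe_le_coe_iff.1 hlt.le
  refine Matrix.PosSemidef.of_dotProduct_mulVec_nonneg
    ((hσ.1.smul (IsSelfAdjoint.all _)).sub hρ) fun x => ?_
  have hcont : Filter.Tendsto (fun l : ℝ => star x ⬝ᵥ (((2 : ℝ) ^ l) • σ - ρ) *ᵥ x)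
      (nhdsWithin k (Set.Ioi k)) (nhds (star x ⬝ᵥ (((2 : ℝ) ^ k) • σ - ρ) *ᵥ x)) := by
    refine Filter.Tendsto.mono_left (Continuous.tendsto ?_ k) nhdsWithin_le_nhds
    have : Continuous fun l : ℝ => (2 : ℝ) ^ l := Real.continuous_const_rpow two_ne_zero
    fun_prop
  refine ge_of_tendsto hcont ?_
  filter_upwards [self_mem_nhdsWithin] with l hl
  exact (hgt l hl).dotProduct_mulVec_nonneg x

theorem nonneg_of_loewner {ι : Type*} [Fintype ι] {ρ σ : Matrix ι ι ℂ} (hρ : ρ.trace = 1)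
    (hσ : σ.trace = 1) {k : ℝ} (h : Loewner ρ (((2 : ℝ) ^ k) • σ)) : 0 ≤ k := by
  have h1 := Matrix.PosSemidef.trace_nonneg h
  rw [Matrix.trace_sub, Matrix.trace_smul, hρ, hσ] at h1
  have h2 := (Complex.le_def.1 h1).1
  simp only [Complex.real_smul, mul_one, Complex.sub_re, Complex.ofReal_re, Complex.one_re,
    Complex.zero_re, sub_nonneg] at h2
  by_contra hk
  exact absurd h2 (not_le.2 (Real.rpow_lt_one_of_one_lt_of_neg one_lt_two (not_le.1 hk)))

theorem marginalLeft_posSemidef {R C : Type*} [Fintype R] [Fintype C]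
    {Ψ : Matrix (R × C) (R × C) ℂ} (h : Ψ.PosSemidef) : (marginalLeft Ψ).PosSemidef := by
  have : marginalLeft Ψ = ∑ c, Ψ.submatrix (fun r => (r, c)) (fun r => (r, c)) := by
    ext
    simp [marginalLeft, Matrix.sum_apply]
  rw [this]
  exact Matrix.posSemidef_sum _ fun c _ => h.submatrix _

/-! ### The harmonic ratio -/

theorem harmonicSum_one (n : ℕ) : harmonicSum 1 n = (harmonic n : ℝ) := by
  rw [harmonicSum, harmonic_eq_sum_Icc]
  push_cast
  simp

theorem one_le_harmonicSum_ratio {a n : ℕ} (ha : 0 < a) (han : a ≤ n) :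
    1 ≤ harmonicSum 1 n / harmonicSum a n := by
  rw [one_le_div (harmonicSum_pos ha han)]
  exact Finset.sum_le_sum_of_subset_of_nonneg (Finset.Icc_subset_Icc_left ha)
    fun _ _ _ => by positivity

theorem le_of_floor_rpow_le {a n : ℕ} {δ : ℝ} (hδ : 0 < δ) (hδ' : δ < 1 / 15)
    (hn : ⌊(a : ℝ) ^ (1 / δ)⌋₊ ≤ n) (ha : 0 < a) : a ≤ n := by
  refine le_trans (Nat.le_floor ?_) hn
  have h1 : (1 : ℝ) ≤ a := by exact_mod_cast ha
  have h2 : 1 ≤ 1 / δ := by rw [one_le_div hδ]; linarith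
  simpa using Real.rpow_le_rpow_of_exponent_le h1 h2

/-- With `n ≥ ⌊a^{1/δ}⌋`, the discarded part `S(1,a-1) ≤ 1 + log a` is at most a fraction
`(1 + 1 / log 2) δ ≤ 5δ/2` of `S(1,n) ≥ log (n+1) ≥ (log a) / δ`, and `- log (1 - 5δ/2) ≤ 15 δ`. -/
theorem logb_harmonicSum_ratio_le {a n : ℕ} {δ : ℝ} (hδ : 0 < δ) (hδ' : δ < 1 / 15)
    (hn : ⌊(a : ℝ) ^ (1 / δ)⌋₊ ≤ n) (ha : 0 < a) :
    Real.logb 2 (harmonicSum 1 n / harmonicSum a n) ≤ 15 * δ := by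
  have han := le_of_floor_rpow_le hδ hδ' hn ha
  have hSa := harmonicSum_pos ha han
  have hS1 : 0 < harmonicSum 1 n := harmonicSum_pos one_pos (ha.trans_le han)
  have hlog2 := Real.log_two_gt_d9
  have hsplit : harmonicSum 1 n = harmonicSum 1 (a - 1) + harmonicSum a n := by
    simp only [harmonicSum]
    rw [← Finset.sum_union (Finset.disjoint_left.2 fun j h1 h2 => by
      simp only [Finset.mem_Icc] at h1 h2; omega)]
    refine Finset.sum_congr ?_ fun _ _ => rfl
    ext j
    simp only [Finset.mem_Icc, Finset.mem_union]
    omega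
  have hfrac : harmonicSum 1 (a - 1) ≤ 5 / 2 * δ * harmonicSum 1 n := by
    rcases Nat.lt_or_ge a 2 with h2 | h2
    · have : a - 1 = 0 := by omega
      rw [this]
      simp only [harmonicSum, Finset.Icc_eq_empty_of_lt Nat.zero_lt_one, Finset.sum_empty]
      positivity
    · have haR : (0 : ℝ) < a := by exact_mod_cast ha
      have hlogle : Real.log 2 ≤ Real.log a := Real.log_le_log two_pos (by exact_mod_cast h2)
      have h3 : harmonicSum 1 (a - 1) ≤ 1 + Real.log a := by
        rw [harmonicSum_one]
        refine (harmonic_le_one_add_log _).trans (add_le_add_right (Real.log_le_log ?_ ?_) _)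
        · exact_mod_cast (by omega : 0 < a - 1)
        · exact_mod_cast Nat.sub_le a 1
      have h4 : 1 / δ * Real.log a ≤ harmonicSum 1 n := by
        rw [harmonicSum_one, ← Real.log_rpow haR]
        refine le_trans (Real.log_le_log (Real.rpow_pos_of_pos haR _) ?_)
          (log_add_one_le_harmonic n)
        push_cast
        exact (Nat.lt_floor_add_one _).le.trans (by gcongr)
      have h5 : Real.log a ≤ δ * harmonicSum 1 n := by
        rw [one_div, inv_mul_le_iff₀ hδ] at h4
        exact h4
      nlinarith
  have hpos : 0 < 1 - 5 / 2 * δ := by linarith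
  have hratio : harmonicSum 1 n / harmonicSum a n ≤ (1 - 5 / 2 * δ)⁻¹ := by
    rw [div_le_iff₀ hSa, inv_mul_eq_div, le_div_iff₀ hpos]
    nlinarith
  rw [Real.logb, div_le_iff₀ (by linarith)]
  calc Real.log (harmonicSum 1 n / harmonicSum a n) ≤ Real.log (1 - 5 / 2 * δ)⁻¹ :=
        Real.log_le_log (div_pos hS1 hSa) hratio
    _ ≤ (1 - 5 / 2 * δ)⁻¹ - 1 := Real.log_le_sub_one_of_pos (inv_pos.2 hpos)
    _ ≤ 3 * δ := by
        rw [sub_le_iff_le_add, inv_le_iff_one_le_mul₀ hpos]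
        nlinarith
    _ ≤ 15 * δ * Real.log 2 := by nlinarith

/-! ### Rounding, labellings and embezzling unitaries -/

section Rounding

variable {C : Type*} [Fintype C] [DecidableEq C] {γ : ℝ} {M : ℕ}

/-- A state is rounded by rounding up the eigenvalues of `(1-γ) ω` to multiples of `γ/|C|`, and
adding what is missing to an arbitrary eigenvalue. -/
theorem exists_isRounding (hγ : 0 < γ) (hγ' : γ ≤ 1 / 2)
    (hM : (Fintype.card C : ℝ) / γ = M) {ω : Matrix C C ℂ} (hω : IsState ω) :
    ∃ (σ V : Matrix C C ℂ) (m : C → ℕ), IsRounding γ ω σ V m := by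
  have hC : Nonempty C := by
    by_contra h
    have := not_nonempty_iff.1 h
    have h1 := hω.2
    simp [Matrix.trace] at h1
  have hcard : (0 : ℝ) < Fintype.card C := Nat.cast_pos.2 Fintype.card_pos
  have hcard' : (Fintype.card C : ℝ) = M * γ := by rw [← hM]; field_simp
  have hMpos : (0 : ℝ) < M := hM ▸ div_pos hcard hγ
  obtain ⟨c₀⟩ := hC
  have hherm := hω.1.1
  set w := hherm.eigenvalues with hw
  set V : Matrix C C ℂ := (hherm.eigenvectorUnitary : Matrix C C ℂ) with hV
  have hspec : ω = V * Matrix.diagonal (fun c => ((w c : ℝ) : ℂ)) * Vᴴ := hherm.spectral_theorem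
  have hVu : V ∈ Matrix.unitaryGroup C ℂ := hherm.eigenvectorUnitary.2
  have hw0 (c : C) : 0 ≤ w c := hω.1.eigenvalues_nonneg c
  have htr (g : C → ℂ) : (V * Matrix.diagonal g * Vᴴ).trace = ∑ c, g c := by
    rw [Matrix.trace_mul_comm, ← Matrix.mul_assoc, ← Matrix.star_eq_conjTranspose,
      Matrix.mem_unitaryGroup_iff'.1 hVu, Matrix.one_mul, Matrix.trace_diagonal]
  have hw1 : ∑ c, w c = 1 := by
    have := hω.2
    rw [hspec, htr] at this
    exact_mod_cast this
  have hγ1 : 0 < 1 - γ := by linarith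
  set m₀ : C → ℕ := fun c => ⌈(1 - γ) * w c * M⌉₊ with hm₀
  have hsum : ∑ c, m₀ c ≤ M := by
    have h1 : (∑ c, m₀ c : ℝ) ≤ ∑ c, ((1 - γ) * w c * M + 1) :=
      Finset.sum_le_sum fun c _ => (Nat.ceil_lt_add_one (by have := hw0 c; positivity)).le
    rw [Finset.sum_add_distrib, ← Finset.sum_mul, ← Finset.mul_sum, hw1] at h1
    simp only [Finset.sum_const, Finset.card_univ, nsmul_eq_mul, mul_one, hcard'] at h1
    have h2 : (∑ c, m₀ c : ℝ) ≤ M := by linarith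
    exact_mod_cast h2
  set m : C → ℕ := fun c => m₀ c + if c = c₀ then M - ∑ c, m₀ c else 0 with hm
  have hmsum : ∑ c, m c = M := by
    simp only [hm, Finset.sum_add_distrib, Finset.sum_ite_eq', Finset.mem_univ, if_true]
    omega
  have hγM : γ / Fintype.card C = (M : ℝ)⁻¹ := by rw [← hM, inv_div]
  refine ⟨_, V, m, ⟨⟨?_, ?_⟩, ?_, hVu, rfl⟩⟩
  · refine (Matrix.PosSemidef.diagonal fun c => ?_).mul_mul_conjTranspose_same V
    exact Complex.zero_le_real.2 (by positivity)
  · rw [htr, ← Complex.ofReal_sum, ← Finset.sum_mul, ← Nat.cast_sum, hmsum, hγM,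
      mul_inv_cancel₀ hMpos.ne', Complex.ofReal_one]
  · have h : (1 / (1 - γ)) • (V * Matrix.diagonal (fun c =>
        (((m c : ℝ) * (γ / Fintype.card C) : ℝ) : ℂ)) * Vᴴ) - ω =
        V * Matrix.diagonal (fun c =>
          ((1 / (1 - γ) * ((m c : ℝ) * (γ / Fintype.card C)) - w c : ℝ) : ℂ)) * Vᴴ := by
      have h1 : Matrix.diagonal (fun c =>
          ((1 / (1 - γ) * ((m c : ℝ) * (γ / Fintype.card C)) - w c : ℝ) : ℂ)) =
          (1 / (1 - γ)) • Matrix.diagonal (fun c =>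
            (((m c : ℝ) * (γ / Fintype.card C) : ℝ) : ℂ)) -
          Matrix.diagonal (fun c => ((w c : ℝ) : ℂ)) := by
        ext i j
        by_cases hij : i = j
        · subst hij
          simp
        · simp [hij]
      rw [h1, Matrix.mul_sub, Matrix.sub_mul, ← hspec, Matrix.mul_smul, Matrix.smul_mul]
    rw [Loewner, h]
    refine (Matrix.PosSemidef.diagonal fun c => ?_).mul_mul_conjTranspose_same V
    refine Complex.zero_le_real.2 (sub_nonneg.2 ?_)
    rw [hγM, one_div, le_inv_mul_iff₀ hγ1, ← div_eq_mul_inv, le_div_iff₀ hMpos]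
    refine (Nat.le_ceil _).trans ?_
    exact_mod_cast Nat.le_add_right _ _

theorem IsRounding.sum_eq {ω σ V : Matrix C C ℂ} {m : C → ℕ} (h : IsRounding γ ω σ V m)
    (hM : (Fintype.card C : ℝ) / γ = M) : ∑ c, m c = M ∧ 0 < M := by
  have h1 := h.state.2
  rw [h.eigen, Matrix.trace_mul_comm, ← Matrix.mul_assoc, ← Matrix.star_eq_conjTranspose,
    Matrix.mem_unitaryGroup_iff'.1 h.unitary, Matrix.one_mul, Matrix.trace_diagonal,
    ← Complex.ofReal_sum, ← Finset.sum_mul, ← inv_div, hM, ← Nat.cast_sum] at h1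
  have h2 : ((∑ c, m c : ℕ) : ℝ) * (M : ℝ)⁻¹ = 1 := by exact_mod_cast h1
  have hM0 : (M : ℝ) ≠ 0 := fun h0 => by simp [h0] at h2
  rw [mul_inv_eq_one₀ hM0] at h2
  exact ⟨by exact_mod_cast h2, Nat.pos_of_ne_zero (by exact_mod_cast hM0)⟩

end Rounding

section Labelling

variable {C : Type*} [Fintype C] {m : C → ℕ} {M p : ℕ}

theorem maxMult_le_sum (m : C → ℕ) : maxMult m ≤ ∑ c, m c :=
  Finset.sup_le fun _ hc => Finset.single_le_sum (fun _ _ => Nat.zero_le _) hc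

theorem maxMult_pos (hm : 0 < ∑ c, m c) : 0 < maxMult m := by
  by_contra h
  have h1 (c : C) : m c = 0 := by
    have : m c ≤ maxMult m := Finset.le_sup (f := m) (Finset.mem_univ c)
    omega
  simp [h1] at hm

theorem Labelling.card_bounds [NeZero p] (L : Labelling m p) (hm : ∑ c, m c = M) :
    M ^ 2 ≤ p ∧ p ≤ 2 * M ^ 2 := by
  classical
  constructor
  · choose g hg using L.covers
    have hinj : Function.Injective fun x : FlatIndex m × FlatIndex m => g x.1 x.2 := by
      intro x y h
      have h1 := congrArg L.toFun h
      simp only [hg] at h1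
      exact Prod.ext (congrArg (fun u => u.2.1) h1) (congrArg (fun u => u.2.2) h1)
    have := Fintype.card_le_of_injective _ hinj
    rwa [Fintype.card_prod, card_flatIndex, hm, ZMod.card, ← sq] at this
  · have := Fintype.card_le_of_injective _ L.injective
    rwa [Fintype.card_prod, Fintype.card_prod, card_flatIndex, hm, ZMod.card, Fintype.card_fin,
      ← sq] at this

theorem nonempty_labelling [NeZero p] (hm : ∑ c, m c = M) (h₁ : M ^ 2 ≤ p) (h₂ : p ≤ 2 * M ^ 2) :
    Nonempty (Labelling m p) := by
  classical
  let T₀ : Finset (Fin 2 × FlatIndex m × FlatIndex m) := {0} ×ˢ Finset.univ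
  have hT₀ : T₀.card ≤ p := by
    rwa [Finset.card_product, Finset.card_singleton, one_mul, Finset.card_univ, Fintype.card_prod,
      card_flatIndex, hm, ← sq]
  have hcard : p ≤ Fintype.card (Fin 2 × FlatIndex m × FlatIndex m) := by
    rwa [Fintype.card_prod, Fintype.card_prod, card_flatIndex, hm, Fintype.card_fin, ← sq]
  obtain ⟨T, hT, hTp⟩ := Finset.exists_superset_card_eq hT₀ hcard
  have e : ZMod p ≃ T := Fintype.equivOfCardEq (by rw [ZMod.card, Fintype.card_coe, hTp])
  refine ⟨⟨fun i => (e i).1, fun i j h => e.injective (Subtype.ext h), fun x y => ?_⟩⟩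
  exact ⟨e.symm ⟨(0, x, y), hT (by simp [T₀])⟩, by simp⟩

end Labelling

/-- The prescribed action is injective on the basis vectors `|j⟩|0⟩` with `j ≥ a`, so it extends to
a permutation of the basis. -/
theorem exists_isEmbezzler {d a b : ℕ} (hba : b ≤ a) :
    ∃ Wb : Matrix (Fin d × Fin a) (Fin d × Fin a) ℂ, IsEmbezzler d b Wb := by
  rcases Nat.eq_zero_or_pos b with rfl | hb
  · exact ⟨1, one_mem _, fun h => absurd h (lt_irrefl _)⟩
  let P (x : Fin d × Fin a) : Prop := a ≤ x.1.val + 1 ∧ x.2.val = 0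
  have hdiv (x : {x // P x}) : 0 < (x.1.1.val + 1) / b := Nat.div_pos (hba.trans x.2.1) hb
  let f (x : {x // P x}) : Fin d × Fin a :=
    (⟨(x.1.1.val + 1) / b - 1, by
        have := hdiv x
        have := Nat.div_le_self (x.1.1.val + 1) b
        omega⟩,
      ⟨(x.1.1.val + 1) % b, (Nat.mod_lt _ hb).trans_le hba⟩)
  have hf : Function.Injective f := by
    rintro ⟨⟨j, e⟩, hj, he⟩ ⟨⟨j', e'⟩, hj', he'⟩ h
    have h1 : (j.val + 1) / b - 1 = (j'.val + 1) / b - 1 :=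
      congrArg (fun u : Fin d × Fin a => u.1.val) h
    have h2 : (j.val + 1) % b = (j'.val + 1) % b :=
      congrArg (fun u : Fin d × Fin a => u.2.val) h
    have h3 : 0 < (j.val + 1) / b := Nat.div_pos (hba.trans hj) hb
    have h4 : 0 < (j'.val + 1) / b := Nat.div_pos (hba.trans hj') hb
    have h5 : (j.val + 1) / b = (j'.val + 1) / b := by omega
    have h6 : j.val + 1 = j'.val + 1 := by
      rw [← Nat.div_add_mod (j.val + 1) b, h5, h2, Nat.div_add_mod]
    exact Subtype.ext (Prod.ext (Fin.ext (by simpa using h6)) (Fin.ext (he.trans he'.symm)))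
  classical
  let π : Equiv.Perm (Fin d × Fin a) :=
    Equiv.extendSubtype (q := fun x => x ∈ Set.range f) (Equiv.ofInjective f hf)
  have hπ (x : {x // P x}) : π x.1 = f x :=
    (Equiv.extendSubtype_apply_of_mem (q := fun x => x ∈ Set.range f) (Equiv.ofInjective f hf)
      x.1 x.2).trans rfl
  refine ⟨(monomialMatrix π 1)ᴴ, ?_, fun _ j e hj _ he j' e' => ?_⟩
  · rw [← Matrix.star_eq_conjTranspose]
    exact Unitary.star_mem (monomialMatrix_mem_unitaryGroup _ _ (by simp))
  · have h1 := hπ ⟨(j, e), hj, he⟩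
    have h2 := hdiv ⟨(j, e), hj, he⟩
    simp only at h1 h2
    simp only [Matrix.conjTranspose_apply, monomialMatrix, Matrix.of_apply, Pi.one_apply, h1, f,
      apply_ite star, star_one, star_zero]
    refine if_congr ?_ rfl rfl
    rw [Prod.mk.injEq, Fin.ext_iff, Fin.ext_iff]
    simp only
    omega

/-! ### The decoupling bound -/

section Decoupling

variable {R C : Type*} [Fintype R] [DecidableEq R] [Fintype C] [DecidableEq C] {γ δ k : ℝ}
  {M : ℕ} {Ψ : Matrix (R × C) (R × C) ℂ} {ω σ V : Matrix C C ℂ} {m : C → ℕ}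

/-- In the eigenbasis of `σ`, `Ψ ≤ 2^k (1-γ)⁻¹ Ψ_R ⊗ σ`. -/
theorem IsRounding.rotate_le (h : IsRounding γ ω σ V m) (hΨ : Ψ.PosSemidef)
    (hk : Loewner Ψ (((2 : ℝ) ^ k) • (marginalLeft Ψ ⊗ₖ ω))) :
    Loewner (rotate V Ψ) (((2 : ℝ) ^ k * (1 / (1 - γ))) • (marginalLeft Ψ ⊗ₖ
      Matrix.diagonal fun c => (((m c : ℝ) * (γ / Fintype.card C) : ℝ) : ℂ))) := by
  have hVV : Vᴴ * V = 1 := Matrix.mem_unitaryGroup_iff'.1 h.unitary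
  have h1 : Loewner Ψ (((2 : ℝ) ^ k) • (marginalLeft Ψ ⊗ₖ ((1 / (1 - γ)) • σ))) :=
    hk.trans ((Loewner.kronecker_right (marginalLeft_posSemidef hΨ) h.dominates).smul
      (by positivity))
  have h2 := rotate_mono (V := V) h1
  have h3 : Vᴴ * σ * V =
      Matrix.diagonal fun c => (((m c : ℝ) * (γ / Fintype.card C) : ℝ) : ℂ) := by
    rw [h.eigen, ← Matrix.mul_assoc, ← Matrix.mul_assoc, hVV, Matrix.one_mul, Matrix.mul_assoc,
      hVV, Matrix.mul_one]
  have h4 : rotate V (((2 : ℝ) ^ k) • (marginalLeft Ψ ⊗ₖ ((1 / (1 - γ)) • σ))) =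
      ((2 : ℝ) ^ k * (1 / (1 - γ))) • (marginalLeft Ψ ⊗ₖ (Vᴴ * σ * V)) := by
    rw [Matrix.kronecker_smul, smul_smul, ← rotate_kronecker]
    simp only [rotate, Matrix.mul_smul, Matrix.smul_mul]
  rwa [h4, h3] at h2

theorem isState_tau_and_relEntropy_tau_le (hγ : 0 < γ) (hγ' : γ ≤ 1 / 2) (hδ : 0 < δ)
    (hδ' : δ < 1 / 15) (hM : (Fintype.card C : ℝ) / γ = M) (hΨ : IsState Ψ) (hω : IsState ω)
    (hk : Loewner Ψ (((2 : ℝ) ^ k) • (marginalLeft Ψ ⊗ₖ ω)))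
    (h : IsRounding γ ω σ V m) {n d : ℕ} (hn : ⌊(maxMult m : ℝ) ^ (1 / δ)⌋₊ ≤ n) (hnd : n ≤ d)
    {Wb : ℕ → Matrix (Fin d × Fin (maxMult m)) (Fin d × Fin (maxMult m)) ℂ}
    (hWb : ∀ b ≤ maxMult m, IsEmbezzler n b (Wb b)) {p : ℕ} [Fact p.Prime]
    (L : Labelling m p) {S : Finset ℕ} (hS : S.Nonempty) (hSM : S ⊆ Finset.range (M ^ 2)) :
    IsState (tau γ n Ψ V m Wb L S) ∧
      relEntropy (tau γ n Ψ V m Wb L S) (target n d p Ψ) ≤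
        ((15 * δ + Real.logb 2 (1 + ((2 : ℝ) ^ (k + 2) - 1) / (S.card : ℝ)) : ℝ) : EReal) := by
  obtain ⟨hmM, hM0⟩ := h.sum_eq hM
  have ha : 0 < maxMult m := maxMult_pos (hmM ▸ hM0)
  have han : maxMult m ≤ n := le_of_floor_rpow_le hδ hδ' hn ha
  obtain ⟨hMp, hpM⟩ := L.card_bounds hmM
  have hMR : (0 : ℝ) < M := Nat.cast_pos.2 hM0
  have hγM : γ / Fintype.card C = (M : ℝ)⁻¹ := by rw [← hM, inv_div]
  have hcard : Fintype.card (FlatIndex m) * (γ / Fintype.card C) = 1 := by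
    rw [card_flatIndex, hmM, hγM, mul_inv_cancel₀ hMR.ne']
  have hpR : (0 : ℝ) < p := Nat.cast_pos.2 (Fact.out : p.Prime).pos
  have hp2 : (γ / Fintype.card C) ^ 2 ≤ 2 / p := by
    rw [hγM, inv_pow, inv_le_iff_one_le_mul₀ (by positivity), mul_comm, ← mul_div_assoc,
      one_le_div hpR]
    have : (p : ℝ) ≤ 2 * (M : ℝ) ^ 2 := by exact_mod_cast hpM
    linarith
  have hΨR := marginalLeft_posSemidef hΨ.1
  have hxi : (xi 1 n d).PosSemidef := by
    rw [xi_eq_diagonal]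
    exact Matrix.PosSemidef.diagonal fun j => Complex.zero_le_real.2 (xiCoeff_nonneg _ _ _)
  have hκ : (marginalLeft Ψ ⊗ₖ xi 1 n d).PosSemidef := hΨR.kronecker hxi
  have hmixed : (mixed (ZMod p)).PosSemidef := Matrix.PosSemidef.one.smul (by positivity)
  have hrot := h.rotate_le hΨ.1 hk
  have hrs := rotate_isState h.unitary hΨ
  set ratio := harmonicSum 1 n / harmonicSum (maxMult m) n with hratio
  have hratio1 : 1 ≤ ratio := one_le_harmonicSum_ratio ha han
  have h2k : (2 : ℝ) ^ (k + 2) = 4 * 2 ^ k := by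
    rw [Real.rpow_add two_pos]
    norm_num [mul_comm]
  have hk0 : 0 ≤ k := nonneg_of_loewner hΨ.2
    (by rw [Matrix.trace_kronecker, trace_marginalLeft, hΨ.2, hω.2, one_mul]) hk
  have h2k1 : (1 : ℝ) ≤ 2 ^ k := Real.one_le_rpow one_le_two hk0
  -- the three properties of the input state which the convex-split bound needs
  have hin := inputState_eq_decode (γ := γ) (n := n) h.unitary Ψ hWb L
  have hin_state : IsState (inputState γ n Ψ V m Wb L) := by
    rw [hin]
    refine ⟨decode_posSemidef hγ.le L hrs.1, ?_⟩
    rw [trace_decode L hcard (fun r c hc => ?_) han hnd, hrs.2]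
    refine le_antisymm ?_ hrs.1.diag_nonneg
    have := Matrix.PosSemidef.diag_nonneg hrot (i := (r, c))
    simpa [hc] using this
  have hin_le : Loewner (inputState γ n Ψ V m Wb L) (((2 : ℝ) ^ (k + 2) * ratio) •
      ((marginalLeft Ψ ⊗ₖ xi 1 n d) ⊗ₖ mixed (ZMod p))) := by
    rw [hin]
    have h1 := decode_mono (d := d) (n := n) hγ.le L hrot
    rw [decode_smul] at h1
    have h1γ : 1 / (1 - γ) ≤ 2 := by
      rw [div_le_iff₀ (by linarith)]
      linarith
    have h1γ0 : 0 ≤ 1 / (1 - γ) := one_div_nonneg.2 (by linarith)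
    refine h1.trans (((decode_kronecker_diagonal_le L hΨR hp2).smul (by positivity)).trans ?_)
    rw [Loewner, smul_smul, ← sub_smul]
    refine (hκ.kronecker hmixed).smul (sub_nonneg.2 ?_)
    rw [h2k]
    nlinarith [mul_nonneg (mul_nonneg (zero_le_one.trans h2k1) (zero_le_one.trans hratio1))
      (sub_nonneg.2 h1γ)]
  have hin_marg : Loewner (marginalLeft (inputState γ n Ψ V m Wb L))
      (ratio • (marginalLeft Ψ ⊗ₖ xi 1 n d)) := by
    rw [hin, ← marginalLeft_rotate h.unitary Ψ]
    exact marginalLeft_decode_le L hrs.1 hcard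
  have hinj : Set.InjOn (Nat.cast : ℕ → ZMod p) S := fun l hl l' hl' hll => by
    have h1 : l < p := (Finset.mem_range.1 (hSM hl)).trans_le hMp
    have h2 : l' < p := (Finset.mem_range.1 (hSM hl')).trans_le hMp
    have := (ZMod.natCast_eq_natCast_iff' l l' p).1 hll
    rwa [Nat.mod_eq_of_lt h1, Nat.mod_eq_of_lt h2] at this
  have hN : (1 : ℝ) ≤ S.card := by exact_mod_cast hS.card_pos
  have hfac : 1 ≤ 1 + ((2 : ℝ) ^ (k + 2) - 1) / (S.card : ℝ) :=
    le_add_of_nonneg_right (div_nonneg (by rw [h2k]; linarith) (by linarith))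
  have hmain := relEntropy_shear_le hin_state hκ hin_le hin_marg hS hinj
    (K := ratio * (1 + ((2 : ℝ) ^ (k + 2) - 1) / (S.card : ℝ))) (by field_simp; ring)
    (one_le_mul_of_one_le_of_one_le hratio1 hfac)
  refine ⟨hmain.1, hmain.2.trans (EReal.coe_le_coe_iff.2 ?_)⟩
  rw [Real.logb_mul (by linarith) (by linarith)]
  exact add_le_add_left (logb_harmonicSum_ratio_le hδ hδ' hn ha) _

end Decoupling

end FlatSplit

theorem theorem4 {R C : Type*} [Fintype R] [DecidableEq R] [Fintype C] [DecidableEq C]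
    (γ δ : ℝ) (hγ : 0 < γ) (hγ' : γ ≤ 1 / 2) (hδ : 0 < δ) (hδ' : δ < 1 / 15)
    (M : ℕ) (hM : (Fintype.card C : ℝ) / γ = M)
    (Ψ : Matrix (R × C) (R × C) ℂ) (hΨ : FlatSplit.IsState Ψ)
    (ω : Matrix C C ℂ) (hω : FlatSplit.IsState ω)
    (k : ℝ) (hk : FlatSplit.dmax Ψ (Matrix.kronecker (FlatSplit.marginalLeft Ψ) ω) = (k : EReal)) :
    -- a rounded state exists
    (∃ (σ V : Matrix C C ℂ) (m : C → ℕ), FlatSplit.IsRounding γ ω σ V m) ∧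
    ∀ (σ V : Matrix C C ℂ) (m : C → ℕ), FlatSplit.IsRounding γ ω σ V m →
      -- the decoupling bound, for all admissible choices of the registers and unitaries
      (∀ (n d : ℕ), ⌊(FlatSplit.maxMult m : ℝ) ^ (1 / δ)⌋₊ ≤ n → n ≤ d →
        ∀ Wb : ℕ → Matrix (Fin d × Fin (FlatSplit.maxMult m))
            (Fin d × Fin (FlatSplit.maxMult m)) ℂ,
        (∀ b ≤ FlatSplit.maxMult m, FlatSplit.IsEmbezzler n b (Wb b)) →
        ∀ (p : ℕ) [Fact p.Prime] (L : FlatSplit.Labelling m p) (S : Finset ℕ),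
        S.Nonempty → S ⊆ Finset.range (M ^ 2) →
          FlatSplit.IsState (FlatSplit.tau γ n Ψ V m Wb L S) ∧
          FlatSplit.relEntropy (FlatSplit.tau γ n Ψ V m Wb L S) (FlatSplit.target n d p Ψ) ≤
            ((15 * δ + Real.logb 2 (1 + ((2 : ℝ) ^ (k + 2) - 1) / (S.card : ℝ)) : ℝ) : EReal)) ∧
      -- the registers and unitaries can be chosen with few additional qubits
      (∃ (n d p : ℕ), ⌊(FlatSplit.maxMult m : ℝ) ^ (1 / δ)⌋₊ ≤ n ∧ d = n ∧ p.Prime ∧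
        Nonempty (FlatSplit.Labelling m p) ∧
        (∃ Wb : ℕ → Matrix (Fin d × Fin (FlatSplit.maxMult m))
            (Fin d × Fin (FlatSplit.maxMult m)) ℂ,
          ∀ b ≤ FlatSplit.maxMult m, FlatSplit.IsEmbezzler n b (Wb b)) ∧
        Real.logb 2 d ≤ (1 / δ) * Real.logb 2 M ∧
        Real.logb 2 d + 2 * Real.logb 2 p ≤ (4 + 1 / δ) * Real.logb 2 M + 2) := by
  have hkL : FlatSplit.Loewner Ψ (((2 : ℝ) ^ k) • (FlatSplit.marginalLeft Ψ ⊗ₖ ω)) :=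
    FlatSplit.loewner_of_dmax_eq hΨ.1.1
      ((FlatSplit.marginalLeft_posSemidef hΨ.1).kronecker hω.1) hk
  refine ⟨FlatSplit.exists_isRounding hγ hγ' hM hω, fun σ V m h => ⟨?_, ?_⟩⟩
  · intro n d hn hnd Wb hWb p _ L S hS hSM
    exact FlatSplit.isState_tau_and_relEntropy_tau_le hγ hγ' hδ hδ' hM hΨ hω hkL h hn hnd hWb L hS
      hSM
  · obtain ⟨hmM, hM0⟩ := h.sum_eq hM
    have ha : 0 < FlatSplit.maxMult m := FlatSplit.maxMult_pos (hmM ▸ hM0)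
    have haR : (0 : ℝ) < FlatSplit.maxMult m := Nat.cast_pos.2 ha
    have haM : (FlatSplit.maxMult m : ℝ) ≤ M := by
      exact_mod_cast (FlatSplit.maxMult_le_sum m).trans hmM.le
    have hMR : (0 : ℝ) < M := Nat.cast_pos.2 hM0
    -- Bertrand's postulate leaves room for the register `F`
    obtain ⟨p, hp, hlt, hle⟩ := Nat.exists_prime_lt_and_le_two_mul (M ^ 2) (by positivity)
    have : NeZero p := ⟨hp.ne_zero⟩
    set n := ⌊(FlatSplit.maxMult m : ℝ) ^ (1 / δ)⌋₊ with hn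
    have hn0 : 0 < n := ha.trans_le (FlatSplit.le_of_floor_rpow_le hδ hδ' le_rfl ha)
    have hlogn : Real.logb 2 n ≤ (1 / δ) * Real.logb 2 M := by
      rw [← Real.logb_rpow_eq_mul_logb_of_pos hMR]
      refine Real.logb_le_logb_of_le one_lt_two (Nat.cast_pos.2 hn0) ?_
      exact (Nat.floor_le (by positivity)).trans
        (Real.rpow_le_rpow haR.le haM (by positivity))
    have hlogp : Real.logb 2 p ≤ 1 + 2 * Real.logb 2 M := by
      have h1 : (p : ℝ) ≤ 2 * (M : ℝ) ^ 2 := by exact_mod_cast hle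
      refine (Real.logb_le_logb_of_le one_lt_two (Nat.cast_pos.2 hp.pos) h1).trans_eq ?_
      rw [Real.logb_mul two_ne_zero (by positivity), Real.logb_self_eq_one one_lt_two,
        Real.logb_pow]
      norm_num
    refine ⟨n, n, p, le_rfl, rfl, hp, FlatSplit.nonempty_labelling hmM hlt.le hle, ?_, hlogn, ?_⟩
    · have hex (b : ℕ) : ∃ Wb : Matrix (Fin n × Fin (FlatSplit.maxMult m))
          (Fin n × Fin (FlatSplit.maxMult m)) ℂ,
          b ≤ FlatSplit.maxMult m → FlatSplit.IsEmbezzler n b Wb := by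
        by_cases hb : b ≤ FlatSplit.maxMult m
        · obtain ⟨W, hW⟩ := FlatSplit.exists_isEmbezzler (d := n) hb
          exact ⟨W, fun _ => hW⟩
        · exact ⟨1, fun h => absurd h hb⟩
      choose Wb hWb using hex
      exact ⟨Wb, hWb⟩
    · linarith
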